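/- Let $\Theta$ be a Borel subset of some $\mathbb R^p$ or a Polish space (more generally, a separable metrizable space whose Borel $\sigma$-field is standard), and let $\mathbb X$ be a standard Borel space. Let $\mu$ be a $\sigma$-finite measure on $\mathbb X$, and let $f:\Theta\times\mathbb X\to[0,\infty]$, $(\theta,x)\mapsto f(x\mid\theta)$, be jointly measurable with $\int f(x\mid\theta)\,d\mu(x)=1$ for every $\theta$. For a probability measure $G$ on $\Theta$ let $F_G$ be the probability measure on $\mathbb X$ with density $f_G(x)=\int_\Theta f(x\mid\theta)\,dG(\theta)$ with respect to $\mu$. Let $(\alpha_n)_{n\ge1}$ be real numbers in $(0,1)$ and let $G_0$ be a probability measure on $\Theta$. For $x_1,x_2,\ldots\in\mathbb X$ define recursively, for $n\ge 1$ and measurable $A\subseteq\Theta$, $$G_n(A)=(1-\alpha_n)\,G_{n-1}(A)+\alpha_n\,\frac{\int_A f(x_n\mid\theta)\,dG_{n-1}(\theta)}{\int_\Theta f(x_n\mid\theta)\,dG_{n-1}(\theta)}$$ (with $G_n=G_{n-1}$ if the denominator is $0$ or $\infty$), so that $G_n$ depends on $x_1,\ldots,x_n$. Let $((X_n,\theta_n))_{n\ge1}$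 be random elements of $\mathbb X\times\Theta$ on a probability space $(\Omega,\mathcal A,P)$ that follow Newton's learning scheme: for every $n\ge1$, * given $X_1,\ldots,X_{n-1}$ and the whole sequence $(\theta_j)_{j\ge1}$, the conditional law of $X_n$ has density $f(\cdot\mid\theta_n)$ with respect to $\mu$; * given $X_1,\ldots,X_{n-1}$, the conditional law of $\theta_n$ is $G_{n-1}$ evaluated at $X_1,\ldots,X_{n-1}$ (so $\theta_1\sim G_0$); or that follow its sequential version: for every $n\ge1$, given $X_1,\ldots,X_{n-1},\theta_1,\ldots,\theta_{n-1}$ the conditional law of $\theta_n$ is $G_{n-1}$ evaluated at $X_1,\ldots,X_{n-1}$, and given $X_1,\ldots,X_{n-1},\theta_1,\ldots,\theta_n$ the conditional law of $X_n$ has density $f(\cdot\mid\theta_n)$ with respect to $\mu$. Suppose that the mixture is identifiable: for probability measures $G,G'$ on $\Theta$, $F_G=F_{G'}$ implies $G=G'$. Then there is a random probability measure $G$ on $\Theta$ such that, $P$-almost surely, $G_n$ (evaluated at $X_1,\ldots,X_n$) converges weakly to $G$, and the sequence $(\theta_n)$ is asymptotically exchangeable with directing random measure $G$. That is, on an extension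 of the probability space $(\Omega,\mathcal A,P)$ there is an exchangeable sequence $(Z_1,Z_2,\ldots)$ in $\Theta$ whose directing random measure (the almost sure weak limit of the empirical distributions $\frac1n\sum_{i=1}^n\delta_{Z_i}$) is $G$, and $$(\theta_{n+1},\theta_{n+2},\ldots)\ \overset{d}{\longrightarrow}\ (Z_1,Z_2,\ldots)\qquad(n\to\infty)$$ in the product topology of $\Theta^{\mathbb N}$. -/

import Mathlib

open MeasureTheory ProbabilityTheory Filter Topology
open scoped ENNReal

namespace NewtonRule

/-- Bayes' rule: the posterior law of the parameter given one observation `x`, when the prior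
is `G` and the sampling density is `f θ`, namely
`A ↦ (∫_A f(x|θ) dG(θ)) / (∫ f(x|θ) dG(θ))`.
Where the quotient has no meaning (normalising constant `0` or `∞`, which almost surely does not
happen for an observation drawn from the mixture) the prior is left unchanged. -/
noncomputable def posterior {Θ 𝕏 : Type*} [MeasurableSpace Θ]
    (f : Θ → 𝕏 → ℝ≥0∞) (G : Measure Θ) (x : 𝕏) : Measure Θ :=
  open Classical in
  if (∫⁻ t, f t x ∂G) = 0 ∨ (∫⁻ t, f t x ∂G) = ∞ then G
  else (∫⁻ t, f t x ∂G)⁻¹ • G.withDensity (fun t => f t x)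

/-- Newton's recursion for the measures `G_n`, along a sequence of observations.
Indices start at `0`: `α n` and `x n` stand for `α_{n+1}` and `x_{n+1}`, so that the measure
with index `n` depends on the first `n` observations only. -/
noncomputable def newtonMeasure {Θ 𝕏 : Type*} [MeasurableSpace Θ] (α : ℕ → ℝ)
    (f : Θ → 𝕏 → ℝ≥0∞) (G₀ : Measure Θ) : ℕ → (ℕ → 𝕏) → Measure Θ
  | 0, _ => G₀
  | n + 1, x =>
      ENNReal.ofReal (1 - α n) • newtonMeasure α f G₀ n x
        + ENNReal.ofReal (α n) • posterior f (newtonMeasure α f G₀ n x) (x n)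

theorem isProbabilityMeasure_posterior {Θ 𝕏 : Type*} [MeasurableSpace Θ]
    (f : Θ → 𝕏 → ℝ≥0∞) (G : Measure Θ) [IsProbabilityMeasure G] (x : 𝕏) :
    IsProbabilityMeasure (posterior f G x) := by
  unfold posterior
  split_ifs with h
  · infer_instance
  · rw [not_or] at h
    refine ⟨?_⟩
    simp only [Measure.smul_apply, smul_eq_mul, withDensity_apply _ MeasurableSet.univ,
      Measure.restrict_univ]
    exact ENNReal.inv_mul_cancel h.1 h.2

theorem isProbabilityMeasure_newtonMeasure {Θ 𝕏 : Type*} [MeasurableSpace Θ] {α : ℕ → ℝ}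
    (hα : ∀ n, α n ∈ Set.Ioo (0 : ℝ) 1) (f : Θ → 𝕏 → ℝ≥0∞) (G₀ : Measure Θ)
    [IsProbabilityMeasure G₀] (n : ℕ) (x : ℕ → 𝕏) :
    IsProbabilityMeasure (newtonMeasure α f G₀ n x) := by
  induction n with
  | zero => simpa [newtonMeasure] using (inferInstance : IsProbabilityMeasure G₀)
  | succ n ih =>
    have := isProbabilityMeasure_posterior f (newtonMeasure α f G₀ n x) (x n)
    refine ⟨?_⟩
    have h1 : (0 : ℝ) ≤ 1 - α n := by linarith [(hα n).2]
    simp only [newtonMeasure, Measure.add_apply, Measure.smul_apply, smul_eq_mul, measure_univ,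
      mul_one]
    rw [← ENNReal.ofReal_add h1 (hα n).1.le]
    simp

/-- Newton's rule `G_n`, as a probability measure, for weights in `(0, 1)`. -/
noncomputable def newtonRule {Θ 𝕏 : Type*} [MeasurableSpace Θ] (α : ℕ → ℝ)
    (hα : ∀ n, α n ∈ Set.Ioo (0 : ℝ) 1) (f : Θ → 𝕏 → ℝ≥0∞) (G₀ : ProbabilityMeasure Θ)
    (n : ℕ) (x : ℕ → 𝕏) : ProbabilityMeasure Θ :=
  ⟨newtonMeasure α f (G₀ : Measure Θ) n x, isProbabilityMeasure_newtonMeasure hα f _ n x⟩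

/-- `f` is a family of probability densities `f(· | θ)` with respect to `μ`, jointly measurable. -/
structure IsDensityFamily {Θ 𝕏 : Type*} [MeasurableSpace Θ] [MeasurableSpace 𝕏]
    (μ : Measure 𝕏) (f : Θ → 𝕏 → ℝ≥0∞) : Prop where
  measurable : Measurable (Function.uncurry f)
  lintegral_eq_one : ∀ t, ∫⁻ x, f t x ∂μ = 1

/-- The mixture `F_G`, with density `f_G(x) = ∫ f(x|θ) dG(θ)` with respect to `μ`. -/
noncomputable def mixture {Θ 𝕏 : Type*} [MeasurableSpace Θ] [MeasurableSpace 𝕏]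
    (μ : Measure 𝕏) (f : Θ → 𝕏 → ℝ≥0∞) (G : Measure Θ) : Measure 𝕏 :=
  μ.withDensity (fun x => ∫⁻ t, f t x ∂G)

/-- Identifiability of the mixture: `F_G` determines the mixing probability measure `G`. -/
def Identifiable {Θ 𝕏 : Type*} [MeasurableSpace Θ] [MeasurableSpace 𝕏]
    (μ : Measure 𝕏) (f : Θ → 𝕏 → ℝ≥0∞) : Prop :=
  ∀ G G' : ProbabilityMeasure Θ,
    mixture μ f (G : Measure Θ) = mixture μ f (G' : Measure Θ) → G = G'

/-- The sigma-field generated by the first `n` terms of a sequence of random elements. -/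
abbrev pastField {Ω E : Type*} [MeasurableSpace E] (Y : ℕ → Ω → E) (n : ℕ) : MeasurableSpace Ω :=
  ⨆ i : Fin n, MeasurableSpace.comap (Y i) inferInstance

/-- The sigma-field generated by a whole sequence of random elements. -/
abbrev fullField {Ω E : Type*} [MeasurableSpace E] (Y : ℕ → Ω → E) : MeasurableSpace Ω :=
  ⨆ i : ℕ, MeasurableSpace.comap (Y i) inferInstance

/-- Newton's learning scheme, with `X n`, `θ n` standing for `X_{n+1}`, `θ_{n+1}`:
* given the earlier observations and the whole latent sequence `(θ_j)_j`, the observation `X n`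
  has density `f(· | θ n)` with respect to `μ`;
* given the first `n` observations, `θ n` has law `G_n` (hence law `G_0` for `n = 0`). -/
structure IsNewtonModel {Ω Θ 𝕏 : Type*} [MeasurableSpace Ω] [MeasurableSpace Θ]
    [MeasurableSpace 𝕏] (P : Measure Ω) (X : ℕ → Ω → 𝕏) (θ : ℕ → Ω → Θ) (μ : Measure 𝕏)
    (f : Θ → 𝕏 → ℝ≥0∞) (α : ℕ → ℝ) (hα : ∀ n, α n ∈ Set.Ioo (0 : ℝ) 1)
    (G₀ : ProbabilityMeasure Θ) : Prop where
  measurable_obs : ∀ n, Measurable (X n)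
  measurable_latent : ∀ n, Measurable (θ n)
  obs_law : ∀ (n : ℕ) (B : Set 𝕏), MeasurableSet B →
    P⟦X n ⁻¹' B | pastField X n ⊔ fullField θ⟧
      =ᵐ[P] fun ω => (μ.withDensity (f (θ n ω))).real B
  latent_law : ∀ (n : ℕ) (A : Set Θ), MeasurableSet A →
    P⟦θ n ⁻¹' A | pastField X n⟧
      =ᵐ[P] fun ω => (newtonRule α hα f G₀ n (fun i => X i ω) : Measure Θ).real A

/-- The sequential version of Newton's learning scheme, in which the pairs `(θ n, X n)` are
generated one after the other:
* given the first `n` observations and the first `n` latent variables, `θ n` has law `G_n`, so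
  that it is conditionally independent of the earlier latent variables given the observations;
* given these and `θ n`, the observation `X n` has density `f(· | θ n)` with respect to `μ`. -/
structure IsSequentialNewtonModel {Ω Θ 𝕏 : Type*} [MeasurableSpace Ω] [MeasurableSpace Θ]
    [MeasurableSpace 𝕏] (P : Measure Ω) (X : ℕ → Ω → 𝕏) (θ : ℕ → Ω → Θ) (μ : Measure 𝕏)
    (f : Θ → 𝕏 → ℝ≥0∞) (α : ℕ → ℝ) (hα : ∀ n, α n ∈ Set.Ioo (0 : ℝ) 1)
    (G₀ : ProbabilityMeasure Θ) : Prop where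
  measurable_obs : ∀ n, Measurable (X n)
  measurable_latent : ∀ n, Measurable (θ n)
  obs_law : ∀ (n : ℕ) (B : Set 𝕏), MeasurableSet B →
    P⟦X n ⁻¹' B | pastField X n ⊔ pastField θ (n + 1)⟧
      =ᵐ[P] fun ω => (μ.withDensity (f (θ n ω))).real B
  latent_law : ∀ (n : ℕ) (A : Set Θ), MeasurableSet A →
    P⟦θ n ⁻¹' A | pastField X n ⊔ pastField θ n⟧
      =ᵐ[P] fun ω => (newtonRule α hα f G₀ n (fun i => X i ω) : Measure Θ).real A

/-- Exchangeability: the law of any initial segment is invariant under permutations. -/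
structure Exchangeable {Ω E : Type*} [MeasurableSpace Ω] [MeasurableSpace E]
    (Q : Measure Ω) (Z : ℕ → Ω → E) : Prop where
  measurable : ∀ n, Measurable (Z n)
  map_perm : ∀ (n : ℕ) (σ : Equiv.Perm (Fin n)),
    Q.map (fun ω (i : Fin n) => Z (σ i) ω) = Q.map (fun ω (i : Fin n) => Z i ω)

/-- The empirical distribution of the first `n + 1` terms of a sequence. -/
noncomputable def empirical {E : Type*} [MeasurableSpace E] (z : ℕ → E) (n : ℕ) :
    ProbabilityMeasure E :=
  ⟨((n + 1 : ℕ) : ℝ≥0∞)⁻¹ • ∑ i ∈ Finset.range (n + 1), Measure.dirac (z i), ⟨by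
    simp only [Measure.smul_apply, Measure.coe_finsetSum, Finset.sum_apply, smul_eq_mul,
      measure_univ, Finset.sum_const, Finset.card_range, nsmul_eq_mul, mul_one]
    exact ENNReal.inv_mul_cancel (by simp) (ENNReal.natCast_ne_top _)⟩⟩

/-- `F` is the directing random measure of the exchangeable sequence `Z`: `Z` is exchangeable and
the random probability measure `F` is the a.s. weak limit of its empirical distributions. -/
structure IsDirectingMeasure {Ω E : Type*} [MeasurableSpace Ω] [TopologicalSpace E]
    [MeasurableSpace E] [OpensMeasurableSpace E]
    (Q : Measure Ω) (Z : ℕ → Ω → E) (F : Ω → ProbabilityMeasure E) : Prop where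
  exchangeable : Exchangeable Q Z
  measurable : Measurable F
  tendsto_empirical :
    ∀ᵐ ω ∂Q, Tendsto (fun n => empirical (fun i => Z i ω) n) atTop (𝓝 (F ω))

/-- `Y` is asymptotically exchangeable with directing random measure `F`: the shifted sequences
`(Y_{n+1}, Y_{n+2}, …)` converge in distribution, in the product topology, to an exchangeable
sequence `(Z_1, Z_2, …)` with directing random measure `F`. The sequence `Z` is allowed to live
on an extension of the probability space `(Ω, P)` that carries `Y` and `F`; the product of `Ω`
with the sequence space, with a law whose first marginal is `P`, is the general such extension. -/
def AsymptoticallyExchangeable {Ω E : Type*} [MeasurableSpace Ω] [TopologicalSpace E]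
    [SecondCountableTopology E] [MeasurableSpace E] [OpensMeasurableSpace E]
    (P : Measure Ω) [IsProbabilityMeasure P] (Y : ℕ → Ω → E)
    (F : Ω → ProbabilityMeasure E) : Prop :=
  ∃ (Q : Measure (Ω × (ℕ → E))) (_ : IsProbabilityMeasure Q),
    Q.map Prod.fst = P ∧
    IsDirectingMeasure Q (fun i p => p.2 i) (fun p => F p.1) ∧
    TendstoInDistribution (fun (n : ℕ) (ω : Ω) (i : ℕ) => Y (n + i) ω) atTop
      (fun p : Ω × (ℕ → E) => p.2) (fun _ => P) Q

end NewtonRule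

/-! In both schemes the observation X_{n+1}, given a suitable past, follows the mixture F_{G_n}. A
posterior averaged over its own mixture is the prior, so G_n(A) is a bounded martingale for each
measurable A. It therefore converges almost surely and has constant mean G_0(A). Because the means
are countably additive, the setwise limits are almost surely countably additive along each fixed
sequence of sets. A distribution function on the rationals then turns them into a genuine random
measure G (`ConvergesSetwise.exists_limit`). A countable π-system of open sets upgrades setwise to
weak convergence.

If variables have predictive laws that converge setwise to G, the mean of a product of k consecutive
indicators tends to E ∏ G(A_i): condition on the last factor, replace its predictive law by the one
known at time n, and repeat (`tendsto_integral_prod_of_condExp`). In the sequential scheme this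
applies directly to θ.

In the original scheme the law of θ_n is known only given the observations, so the argument applies
to X, with predictive laws F_{G_n}. The observations are independent given θ, hence E ∏
F_{θ_{n+i}}(B_i) tends to E ∏ F_G(B_i). Identifiability makes the span of the functions t ↦ F_t(B)
dense in L²(G_0): a function orthogonal to all of them has positive and negative parts with the same
mixture. Every θ_n has law G_0, so approximation errors are uniform in n, and each F_t(B_i) can be
exchanged, one coordinate at a time, for an arbitrary indicator
(`Identifiable.tendsto_integral_comp_mul`, `IsNewtonModel.tendsto_integral_prod_aux`).

Finally E ∏ G(A_i) is the mass of a box under the mixture of i.i.d. sequences directed by G. Boxes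
determine convergence in distribution, and the strong law identifies the directing measure. -/

namespace NewtonRule

/-- The upper limit of the masses given to a set by a sequence of random probability measures. -/
noncomputable def limsupMass {Ω Θ : Type*} [MeasurableSpace Θ] (κ : ℕ → Ω → ProbabilityMeasure Θ)
    (A : Set Θ) (ω : Ω) : ℝ≥0∞ :=
  limsup (fun n => (κ n ω : Measure Θ) A) atTop

/-- A sequence of random probability measures with a constant mean, whose values on each
measurable set converge almost surely. -/
structure ConvergesSetwise {Ω Θ : Type*} [MeasurableSpace Ω] [MeasurableSpace Θ]
    (P : Measure Ω) (κ : ℕ → Ω → ProbabilityMeasure Θ) (ν : ProbabilityMeasure Θ) : Prop where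
  measurable : ∀ n, Measurable (κ n)
  mean : ∀ n A, MeasurableSet A → ∫⁻ ω, (κ n ω : Measure Θ) A ∂P = (ν : Measure Θ) A
  exists_tendsto : ∀ A, MeasurableSet A →
    ∀ᵐ ω ∂P, ∃ c, Tendsto (fun n => (κ n ω : Measure Θ) A) atTop (𝓝 c)

/-! ### Setwise almost sure limits of random measures -/

section SetwiseLimit

variable {Ω Θ : Type*} [MeasurableSpace Θ] {κ : ℕ → Ω → ProbabilityMeasure Θ} {ν : ProbabilityMeasure Θ}

theorem limsupMass_mono {A B : Set Θ} (h : A ⊆ B) (ω : Ω) :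
    limsupMass κ A ω ≤ limsupMass κ B ω :=
  limsup_le_limsup (Eventually.of_forall fun _ => measure_mono h)

theorem limsupMass_le_one (A : Set Θ) (ω : Ω) : limsupMass κ A ω ≤ 1 :=
  limsup_le_of_le (h := Eventually.of_forall fun _ => prob_le_one)

theorem limsupMass_ne_top (A : Set Θ) (ω : Ω) : limsupMass κ A ω ≠ ∞ :=
  ne_top_of_le_ne_top ENNReal.one_ne_top (limsupMass_le_one A ω)

@[simp] theorem limsupMass_empty (ω : Ω) : limsupMass κ ∅ ω = 0 := by
  simp [limsupMass]

@[simp] theorem limsupMass_univ (ω : Ω) : limsupMass κ Set.univ ω = 1 := by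
  simp [limsupMass]

variable [MeasurableSpace Ω] {P : Measure Ω}

theorem measurable_coe_apply {κ : Ω → ProbabilityMeasure Θ} (h : Measurable κ) {A : Set Θ}
    (hA : MeasurableSet A) : Measurable fun ω => (κ ω : Measure Θ) A :=
  (Measure.measurable_coe hA).comp (measurable_subtype_coe.comp h)

theorem ConvergesSetwise.measurable_limsupMass (h : ConvergesSetwise P κ ν) {A : Set Θ} (hA : MeasurableSet A) :
    Measurable (limsupMass κ A) :=
  Measurable.limsup fun n => measurable_coe_apply (h.measurable n) hA

theorem ConvergesSetwise.tendsto_limsupMass (h : ConvergesSetwise P κ ν) {A : Set Θ} (hA : MeasurableSet A) :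
    ∀ᵐ ω ∂P, Tendsto (fun n => (κ n ω : Measure Θ) A) atTop (𝓝 (limsupMass κ A ω)) := by
  filter_upwards [h.exists_tendsto A hA] with ω ⟨c, hc⟩
  rw [limsupMass, hc.limsup_eq]
  exact hc

theorem ConvergesSetwise.lintegral_limsupMass [IsProbabilityMeasure P] (h : ConvergesSetwise P κ ν)
    {A : Set Θ} (hA : MeasurableSet A) :
    ∫⁻ ω, limsupMass κ A ω ∂P = (ν : Measure Θ) A := by
  refine tendsto_nhds_unique (tendsto_lintegral_of_dominated_convergence (fun _ => 1)
    (fun n => measurable_coe_apply (h.measurable n) hA)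
    (fun n => Eventually.of_forall fun ω => prob_le_one) (by simp) (h.tendsto_limsupMass hA)) ?_
  simp_rw [h.mean _ A hA]
  exact tendsto_const_nhds

/-- The values increase and stay below the value at the union, and their integrals converge to its
integral by continuity of `ν`. This forces almost sure convergence. Continuity of the mean thus
replaces any uniformity in the setwise limits. -/
theorem ConvergesSetwise.tendsto_limsupMass_iUnion [IsProbabilityMeasure P] (h : ConvergesSetwise P κ ν)
    {S : ℕ → Set Θ} (hS : ∀ i, MeasurableSet (S i))
    (hmono : Monotone S) :
    ∀ᵐ ω ∂P, Tendsto (fun i => limsupMass κ (S i) ω) atTop (𝓝 (limsupMass κ (⋃ i, S i) ω)) := by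
  refine tendsto_of_lintegral_tendsto_of_monotone
    (h.measurable_limsupMass (MeasurableSet.iUnion hS)).aemeasurable ?_
    (Eventually.of_forall fun ω i j hij => limsupMass_mono (hmono hij) ω)
    (Eventually.of_forall fun ω i => limsupMass_mono (Set.subset_iUnion S i) ω) ?_
  · simp_rw [h.lintegral_limsupMass (hS _), h.lintegral_limsupMass (MeasurableSet.iUnion hS)]
    exact tendsto_measure_iUnion_atTop hmono
  · rw [h.lintegral_limsupMass (MeasurableSet.iUnion hS)]
    finiteness

theorem ConvergesSetwise.tendsto_limsupMass_iInter [IsProbabilityMeasure P] (h : ConvergesSetwise P κ ν)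
    {S : ℕ → Set Θ} (hS : ∀ i, MeasurableSet (S i))
    (hanti : Antitone S) :
    ∀ᵐ ω ∂P, Tendsto (fun i => limsupMass κ (S i) ω) atTop (𝓝 (limsupMass κ (⋂ i, S i) ω)) := by
  refine tendsto_of_lintegral_tendsto_of_antitone
    (fun i => (h.measurable_limsupMass (hS i)).aemeasurable) ?_
    (Eventually.of_forall fun ω i j hij => limsupMass_mono (hanti hij) ω)
    (Eventually.of_forall fun ω i => limsupMass_mono (Set.iInter_subset S i) ω) ?_
  · simp_rw [h.lintegral_limsupMass (hS _), h.lintegral_limsupMass (MeasurableSet.iInter hS)]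
    exact tendsto_measure_iInter_atTop (fun i => (hS i).nullMeasurableSet) hanti
      ⟨0, by finiteness⟩
  · rw [h.lintegral_limsupMass (hS 0)]
    finiteness

theorem ConvergesSetwise.limsupMass_compl [IsProbabilityMeasure P] (h : ConvergesSetwise P κ ν)
    {A : Set Θ} (hA : MeasurableSet A) :
    ∀ᵐ ω ∂P, limsupMass κ Aᶜ ω = 1 - limsupMass κ A ω := by
  filter_upwards [h.tendsto_limsupMass hA, h.tendsto_limsupMass hA.compl] with ω h1 h2
  refine tendsto_nhds_unique h2 ?_
  simp_rw [prob_compl_eq_one_sub hA]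
  exact ENNReal.Tendsto.sub tendsto_const_nhds h1 (Or.inl ENNReal.one_ne_top)

/-- Finite additivity passes to the limit and gives `≥`. Both sides have the same finite integral,
by countable additivity of `ν`, so they agree almost surely. The null set depends on the sequence of
sets, which is why a measure still has to be constructed. -/
theorem ConvergesSetwise.limsupMass_iUnion [IsProbabilityMeasure P] (h : ConvergesSetwise P κ ν)
    {S : ℕ → Set Θ} (hS : ∀ i, MeasurableSet (S i))
    (hd : Pairwise (Function.onFun Disjoint S)) :
    ∀ᵐ ω ∂P, limsupMass κ (⋃ i, S i) ω = ∑' i, limsupMass κ (S i) ω := by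
  have hle : (fun ω => ∑' i, limsupMass κ (S i) ω) ≤ᵐ[P] limsupMass κ (⋃ i, S i) := by
    filter_upwards [ae_all_iff.2 fun i => h.tendsto_limsupMass (hS i),
      h.tendsto_limsupMass (MeasurableSet.iUnion hS)] with ω h1 h2
    refine ENNReal.tsum_le_of_sum_range_le fun n => ?_
    refine le_of_tendsto_of_tendsto' (tendsto_finsetSum (Finset.range n) fun i _ => h1 i) h2
      fun m => ?_
    rw [measure_iUnion hd hS]
    exact ENNReal.sum_le_tsum _
  refine (ae_eq_of_ae_le_of_lintegral_le hle ?_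
    (h.measurable_limsupMass (MeasurableSet.iUnion hS)).aemeasurable ?_).mono fun ω hω => hω.symm
  · refine ne_top_of_le_ne_top ?_ (lintegral_mono_ae hle)
    rw [h.lintegral_limsupMass (MeasurableSet.iUnion hS)]
    finiteness
  · rw [h.lintegral_limsupMass (MeasurableSet.iUnion hS),
      lintegral_tsum fun i => (h.measurable_limsupMass (hS i)).aemeasurable, measure_iUnion hd hS]
    simp_rw [h.lintegral_limsupMass (hS _)]
    exact le_rfl

theorem ConvergesSetwise.lintegral_limit [IsProbabilityMeasure P] (h : ConvergesSetwise P κ ν)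
    {G : Ω → ProbabilityMeasure Θ} (hG : ∀ A, MeasurableSet A → ∀ᵐ ω ∂P,
      Tendsto (fun n => (κ n ω : Measure Θ) A) atTop (𝓝 ((G ω : Measure Θ) A)))
    (A : Set Θ) (hA : MeasurableSet A) :
    ∫⁻ ω, (G ω : Measure Θ) A ∂P = (ν : Measure Θ) A := by
  rw [← h.lintegral_limsupMass hA]
  refine lintegral_congr_ae ?_
  filter_upwards [hG A hA] with ω hω
  exact hω.limsup_eq.symm

section StandardBorel

variable [StandardBorelSpace Θ]

/-- The limiting distribution function, at rational points, after an embedding into the line. -/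
noncomputable def limitRatCDF (κ : ℕ → Ω → ProbabilityMeasure Θ) (ω : Ω) (q : ℚ) : ℝ :=
  (limsupMass κ (embeddingReal Θ ⁻¹' Set.Iic (q : ℝ)) ω).toReal

theorem ConvergesSetwise.measurable_limitRatCDF (h : ConvergesSetwise P κ ν) :
    Measurable (limitRatCDF κ) :=
  measurable_pi_iff.2 fun _ => (h.measurable_limsupMass
    ((measurable_embeddingReal Θ) measurableSet_Iic)).ennreal_toReal

/-- Being a distribution function on the rationals amounts to countably many limits along monotone
sequences of half-lines, so a single null set suffices. -/
theorem ConvergesSetwise.isRatStieltjesPoint_limitRatCDF [IsProbabilityMeasure P]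
    (h : ConvergesSetwise P κ ν) :
    ∀ᵐ ω ∂P, IsRatStieltjesPoint (limitRatCDF κ) ω := by
  have hme := measurable_embeddingReal Θ
  have hmono : ∀ ω, Monotone (limitRatCDF κ ω) := fun ω p q hpq =>
    ENNReal.toReal_mono (limsupMass_ne_top _ _)
      (limsupMass_mono (Set.preimage_mono (Set.Iic_subset_Iic.2 (by exact_mod_cast hpq))) ω)
  have htop : ∀ᵐ ω ∂P, Tendsto (fun n : ℕ => limitRatCDF κ ω n) atTop (𝓝 1) := by
    have := h.tendsto_limsupMass_iUnion
      (S := fun n : ℕ => embeddingReal Θ ⁻¹' Set.Iic (((n : ℚ) : ℝ)))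
      (fun i => hme measurableSet_Iic)
      (fun i j hij => Set.preimage_mono (Set.Iic_subset_Iic.2 (by exact_mod_cast hij)))
    have hU : (⋃ n : ℕ, embeddingReal Θ ⁻¹' Set.Iic (((n : ℚ) : ℝ))) = Set.univ := by
      refine Set.eq_univ_of_forall fun t => ?_
      obtain ⟨n, hn⟩ := exists_nat_ge (embeddingReal Θ t)
      exact Set.mem_iUnion.2 ⟨n, by simpa using hn⟩
    rw [hU] at this
    filter_upwards [this] with ω hω
    simpa [limitRatCDF, Function.comp_def] using (ENNReal.tendsto_toReal (by simp)).comp hω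
  have hbot : ∀ᵐ ω ∂P, Tendsto (fun n : ℕ => limitRatCDF κ ω (-n)) atTop (𝓝 0) := by
    have := h.tendsto_limsupMass_iInter
      (S := fun n : ℕ => embeddingReal Θ ⁻¹' Set.Iic (((-n : ℚ) : ℝ)))
      (fun i => hme measurableSet_Iic)
      (fun i j hij => Set.preimage_mono (Set.Iic_subset_Iic.2 (by
        push_cast; exact neg_le_neg (by exact_mod_cast hij))))
    have hU : (⋂ n : ℕ, embeddingReal Θ ⁻¹' Set.Iic (((-n : ℚ) : ℝ))) = ∅ := by
      refine Set.eq_empty_of_forall_notMem fun t ht => ?_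
      obtain ⟨n, hn⟩ := exists_nat_gt (-embeddingReal Θ t)
      have := Set.mem_iInter.1 ht n
      simp only [Set.mem_preimage, Set.mem_Iic, Rat.cast_neg, Rat.cast_natCast] at this
      linarith
    rw [hU] at this
    filter_upwards [this] with ω hω
    simpa [limitRatCDF, Function.comp_def] using (ENNReal.tendsto_toReal (by simp)).comp hω
  have hright : ∀ t : ℚ, ∀ᵐ ω ∂P,
      Tendsto (fun n : ℕ => limitRatCDF κ ω (t + 1 / (n + 1))) atTop (𝓝 (limitRatCDF κ ω t)) := by
    intro t
    have := h.tendsto_limsupMass_iInter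
      (S := fun n : ℕ => embeddingReal Θ ⁻¹' Set.Iic (((t + 1 / (n + 1) : ℚ) : ℝ)))
      (fun i => hme measurableSet_Iic)
      (fun i j hij => Set.preimage_mono (Set.Iic_subset_Iic.2 (by
        have : (1 / (j + 1) : ℚ) ≤ 1 / (i + 1) := by gcongr
        exact_mod_cast add_le_add_right this t)))
    have hU : (⋂ n : ℕ, embeddingReal Θ ⁻¹' Set.Iic (((t + 1 / (n + 1) : ℚ) : ℝ)))
        = embeddingReal Θ ⁻¹' Set.Iic (t : ℝ) := by
      ext s
      simp only [Set.mem_iInter, Set.mem_preimage, Set.mem_Iic]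
      refine ⟨fun hs => ?_, fun hs n => hs.trans ?_⟩
      · have hlim : Tendsto (fun n : ℕ => (t : ℝ) + 1 / ((n : ℝ) + 1)) atTop (𝓝 t) := by
          simpa using tendsto_const_nhds.add (tendsto_one_div_add_atTop_nhds_zero_nat (𝕜 := ℝ))
        exact ge_of_tendsto' hlim fun n => by simpa using hs n
      · have : (0 : ℚ) ≤ 1 / (n + 1) := by positivity
        exact_mod_cast le_add_of_nonneg_right this
    rw [hU] at this
    filter_upwards [this] with ω hω
    exact (ENNReal.tendsto_toReal (limsupMass_ne_top _ _)).comp hω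
  filter_upwards [htop, hbot, ae_all_iff.2 hright] with ω h1 h2 h3
  refine ⟨hmono ω, ?_, ?_, fun t => ?_⟩
  · exact (tendsto_iff_tendsto_subseq_of_monotone (hmono ω) tendsto_natCast_atTop_atTop).2 h1
  · have hanti : Antitone fun q : ℚ => limitRatCDF κ ω (-q) :=
      fun p q hpq => hmono ω (neg_le_neg hpq)
    have := (tendsto_iff_tendsto_subseq_of_antitone hanti
      (tendsto_natCast_atTop_atTop (R := ℚ))).2 h2
    simpa [Function.comp_def] using this.comp tendsto_neg_atBot_atTop
  · refine le_antisymm (ge_of_tendsto' (h3 t) fun n => ?_) (le_ciInf fun r => hmono ω r.2.le)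
    have hpos : (0 : ℚ) < 1 / (n + 1) := by positivity
    exact ciInf_le (f := fun r : Set.Ioi t => limitRatCDF κ ω r)
      ⟨0, by rintro _ ⟨r, rfl⟩; exact ENNReal.toReal_nonneg⟩
      ⟨t + 1 / (n + 1), lt_add_of_pos_right t hpos⟩

/-- Induction from half-lines to all Borel sets, carried out on the almost sure statement: each set
operation costs only countably many null sets. -/
theorem ConvergesSetwise.limsupMass_eq_stieltjes [IsProbabilityMeasure P]
    (h : ConvergesSetwise P κ ν) {S : Set ℝ} (hS : MeasurableSet S) :
    ∀ᵐ ω ∂P, limsupMass κ (embeddingReal Θ ⁻¹' S) ω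
      = (stieltjesOfMeasurableRat (limitRatCDF κ) h.measurable_limitRatCDF ω).measure S := by
  have hme := measurable_embeddingReal Θ
  induction S, hS using MeasurableSpace.induction_on_inter
    (BorelSpace.measurable_eq.trans Real.borel_eq_generateFrom_Iic_rat)
    Real.isPiSystem_Iic_rat with
  | empty => simp
  | basic S hS =>
    obtain ⟨q, rfl⟩ : ∃ q : ℚ, Set.Iic (q : ℝ) = S := by simpa [eq_comm] using hS
    filter_upwards [h.isRatStieltjesPoint_limitRatCDF] with ω hω
    rw [measure_stieltjesOfMeasurableRat_Iic, stieltjesOfMeasurableRat_eq,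
      toRatCDF_of_isRatStieltjesPoint hω, limitRatCDF,
      ENNReal.ofReal_toReal (limsupMass_ne_top _ _)]
  | compl S hS ih =>
    filter_upwards [ih, h.limsupMass_compl (hme hS)] with ω h1 h2
    rw [prob_compl_eq_one_sub hS, Set.preimage_compl, h2, h1]
  | iUnion S hd hS ih =>
    have hd' : Pairwise (Function.onFun Disjoint fun i => embeddingReal Θ ⁻¹' S i) :=
      fun i j hij => (hd hij).preimage _
    filter_upwards [ae_all_iff.2 ih, h.limsupMass_iUnion (fun i => hme (hS i)) hd'] with ω h1 h2
    rw [measure_iUnion hd hS, Set.preimage_iUnion, h2]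
    simp_rw [h1]

/-- A sequence of random probability measures with constant mean that converges almost surely on
each measurable set has a random probability measure as its limit. -/
theorem ConvergesSetwise.exists_limit [IsProbabilityMeasure P] (h : ConvergesSetwise P κ ν) :
    ∃ G : Ω → ProbabilityMeasure Θ, Measurable G ∧ ∀ A, MeasurableSet A →
      ∀ᵐ ω ∂P, Tendsto (fun n => (κ n ω : Measure Θ) A) atTop (𝓝 ((G ω : Measure Θ) A)) := by
  classical
  have he := measurableEmbedding_embeddingReal Θ
  let ρ : Ω → Measure ℝ := fun ω =>
    (stieltjesOfMeasurableRat (limitRatCDF κ) h.measurable_limitRatCDF ω).measure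
  have hρ : Measurable ρ := measurable_measure_stieltjesOfMeasurableRat h.measurable_limitRatCDF
  have hprob : ∀ ω, ρ ω (Set.range (embeddingReal Θ)) = 1 →
      IsProbabilityMeasure ((ρ ω).comap (embeddingReal Θ)) := fun ω hω =>
    ⟨by rw [he.comap_apply, Set.image_univ, hω]⟩
  -- The measure on the line may fail to be carried by the image of `Θ` on a null set; there any
  -- fixed law, such as `ν`, serves as a default.
  let G : Ω → ProbabilityMeasure Θ := fun ω =>
    if hω : ρ ω (Set.range (embeddingReal Θ)) = 1 then
      ⟨(ρ ω).comap (embeddingReal Θ), hprob ω hω⟩ else ν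
  have hset : MeasurableSet {ω | ρ ω (Set.range (embeddingReal Θ)) = 1} :=
    (Measure.measurable_coe he.measurableSet_range).comp hρ (measurableSet_singleton 1)
  have hG : ∀ ω, ρ ω (Set.range (embeddingReal Θ)) = 1 → ∀ A,
      (G ω : Measure Θ) A = ρ ω (embeddingReal Θ '' A) := fun ω hω A => by
    have : G ω = ⟨_, hprob ω hω⟩ := dif_pos hω
    rw [this, ProbabilityMeasure.coe_mk, he.comap_apply]
  refine ⟨G, Measurable.subtype_mk (Measure.measurable_of_measurable_coe _ fun A hA => ?_),
    fun A hA => ?_⟩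
  · have : (fun ω => (G ω : Measure Θ) A) = fun ω =>
        if ρ ω (Set.range (embeddingReal Θ)) = 1 then ρ ω (embeddingReal Θ '' A)
          else (ν : Measure Θ) A := by
      ext ω
      split_ifs with hω
      · exact hG ω hω A
      · rw [show G ω = ν from dif_neg hω]
    change Measurable fun ω => (G ω : Measure Θ) A
    rw [this]
    exact Measurable.ite hset
      ((Measure.measurable_coe (he.measurableSet_image.2 hA)).comp hρ) measurable_const
  · filter_upwards [h.tendsto_limsupMass hA,
      h.limsupMass_eq_stieltjes (he.measurableSet_image.2 hA),
      h.limsupMass_eq_stieltjes he.measurableSet_range] with ω h1 h2 h3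
    rw [Set.preimage_range, limsupMass_univ] at h3
    rw [Set.preimage_image_eq _ he.injective] at h2
    rwa [hG ω h3.symm A, ← h2]

end StandardBorel

end SetwiseLimit

/-! ### Integrating against a conditional law -/

section Conditioning

variable {Ω E : Type*} {m mΩ : MeasurableSpace Ω} [mE : MeasurableSpace E] {P : Measure Ω}
  [IsProbabilityMeasure P]

theorem integral_mul_eq_of_condExp (hm : m ≤ mΩ) {Z U V : Ω → ℝ} {C : ℝ}
    (hZ : StronglyMeasurable[m] Z) (hZb : ∀ ω, |Z ω| ≤ C) (hU : Integrable U P)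
    (h : P[U | m] =ᵐ[P] V) : ∫ ω, Z ω * U ω ∂P = ∫ ω, Z ω * V ω ∂P := by
  have hZU : Integrable (Z * U) P :=
    hU.bdd_mul (hZ.mono hm).aestronglyMeasurable (Eventually.of_forall hZb)
  calc ∫ ω, Z ω * U ω ∂P = ∫ ω, (P[Z * U | m]) ω ∂P := (integral_condExp hm).symm
    _ = ∫ ω, Z ω * V ω ∂P := by
      refine integral_congr_ae ?_
      filter_upwards [condExp_mul_of_stronglyMeasurable_left hZ hZU hU, h] with ω h1 h2
      rw [h1, Pi.mul_apply, h2]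

/-- The hypothesis says that the law of `(ω, Y ω)` and `P ⊗ₘ K` agree on rectangles `D ×ˢ B` with
`D` in `m`. These generate only `m.prod mE`, so the two measures are compared after trimming. -/
theorem lintegral_prodMk_of_condExp (hm : m ≤ mΩ) {Y : Ω → E} (hY : Measurable Y)
    {κ : Ω → ProbabilityMeasure E} (hκ : Measurable[m] κ)
    (h : ∀ B, MeasurableSet B →
      P⟦Y ⁻¹' B | m⟧ =ᵐ[P] fun ω => (κ ω : Measure E).real B)
    {H : Ω × E → ℝ≥0∞} (hH : Measurable[m.prod mE] H) :
    ∫⁻ ω, H (ω, Y ω) ∂P = ∫⁻ ω, ∫⁻ y, H (ω, y) ∂(κ ω : Measure E) ∂P := by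
  have hle : m.prod mE ≤ mΩ.prod mE := sup_le_sup_right (MeasurableSpace.comap_mono hm) _
  have hH' : Measurable H := hH.mono hle le_rfl
  let K : Kernel Ω E := ⟨fun ω => (κ ω : Measure E),
    measurable_subtype_coe.comp (hκ.mono hm le_rfl)⟩
  have : IsMarkovKernel K := ⟨fun ω => inferInstanceAs (IsProbabilityMeasure (κ ω : Measure E))⟩
  have hpair : Measurable fun ω => (ω, Y ω) := measurable_id.prodMk hY
  have : IsProbabilityMeasure (P.map fun ω => (ω, Y ω)) :=
    Measure.isProbabilityMeasure_map hpair.aemeasurable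
  suffices htrim : (P.map fun ω => (ω, Y ω)).trim hle = (P ⊗ₘ K).trim hle by
    calc ∫⁻ ω, H (ω, Y ω) ∂P = ∫⁻ p, H p ∂(P.map fun ω => (ω, Y ω)) :=
          (lintegral_map hH' hpair).symm
      _ = ∫⁻ p, H p ∂(P ⊗ₘ K) := by
          rw [← lintegral_trim hle hH, ← lintegral_trim hle hH, htrim]
      _ = _ := Measure.lintegral_compProd hH'
  refine ext_of_generate_finite _ (@generateFrom_prod _ _ m mE).symm
    (@isPiSystem_prod _ _ m mE) ?_ ?_
  · rintro _ ⟨D, hD, B, hB, rfl⟩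
    have hDB : MeasurableSet[m.prod mE] (D ×ˢ B) := @MeasurableSet.prod _ _ m mE _ _ hD hB
    have hDB' : MeasurableSet (D ×ˢ B) := hle _ hDB
    have hK : Measurable fun ω => K ω B := K.measurable_coe hB
    rw [trim_measurableSet_eq hle hDB, trim_measurableSet_eq hle hDB,
      Measure.map_apply hpair hDB', Measure.compProd_apply_prod (hm _ hD) hB]
    have h1 : (fun ω => (ω, Y ω)) ⁻¹' D ×ˢ B = Y ⁻¹' B ∩ D := by
      ext ω; simp [and_comm]
    have hint : Integrable ((Y ⁻¹' B).indicator fun _ => (1 : ℝ)) P :=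
      (integrable_const 1).indicator (hY hB)
    have h2 := setIntegral_condExp hm hint hD
    rw [setIntegral_congr_ae (hm _ hD) ((h B hB).mono fun ω hω _ => hω)] at h2
    rw [h1, ← ENNReal.ofReal_toReal (measure_ne_top P (Y ⁻¹' B ∩ D))]
    have h3 : (P (Y ⁻¹' B ∩ D)).toReal = ∫ ω in D, (Y ⁻¹' B).indicator (fun _ => (1 : ℝ)) ω ∂P := by
      rw [integral_indicator_const _ (hY hB)]
      simp [measureReal_def, Measure.restrict_apply (hY hB)]
    rw [h3, ← h2, ofReal_integral_eq_lintegral_ofReal _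
      (Eventually.of_forall fun ω => measureReal_nonneg)]
    · exact lintegral_congr fun ω => ENNReal.ofReal_toReal (measure_ne_top _ _)
    · exact Integrable.of_bound hK.ennreal_toReal.aestronglyMeasurable 1
        (Eventually.of_forall fun ω => by
          rw [Real.norm_of_nonneg measureReal_nonneg]
          exact measureReal_le_one)
  · rw [trim_measurableSet_eq hle MeasurableSet.univ, trim_measurableSet_eq hle MeasurableSet.univ,
      measure_univ, measure_univ]

end Conditioning

/-! ### Products of consecutive variables with converging conditional means -/

section ProductLimit

variable {Ω : Type*} {mΩ : MeasurableSpace Ω} {P : Measure Ω} [IsProbabilityMeasure P]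

theorem abs_prod_mul_le_one {ι : Type*} (s : Finset ι) {a : ι → ℝ} {b : ℝ}
    (ha : ∀ i, |a i| ≤ 1) (hb : |b| ≤ 1) : |(∏ i ∈ s, a i) * b| ≤ 1 := by
  rw [abs_mul, Finset.abs_prod]
  exact mul_le_one₀ (Finset.prod_le_one (fun i _ => abs_nonneg _) fun i _ => ha i) (abs_nonneg _) hb

/-- If the conditional means of bounded variables converge along a filtration, then the mean of
the product of `k` consecutive ones converges to the mean of the product of the limits. -/
theorem tendsto_integral_prod_of_condExp {𝓗 : Filtration ℕ mΩ} {U V : ℕ → ℕ → Ω → ℝ}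
    {V' : ℕ → Ω → ℝ} (hU : ∀ i n, StronglyMeasurable[𝓗 (n + 1)] (U i n))
    (hUb : ∀ i n ω, |U i n ω| ≤ 1) (hV : ∀ i n, StronglyMeasurable[𝓗 n] (V i n))
    (hVb : ∀ i n ω, |V i n ω| ≤ 1) (hUV : ∀ i n, P[U i n | 𝓗 n] =ᵐ[P] V i n)
    (hlim : ∀ i, ∀ᵐ ω ∂P, Tendsto (fun n => V i n ω) atTop (𝓝 (V' i ω)))
    (k : ℕ) {W : ℕ → Ω → ℝ} {W' : Ω → ℝ} (hW : ∀ n, StronglyMeasurable[𝓗 n] (W n))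
    (hWb : ∀ n ω, |W n ω| ≤ 1)
    (hWlim : ∀ᵐ ω ∂P, Tendsto (fun n => W n ω) atTop (𝓝 (W' ω))) :
    Tendsto (fun n => ∫ ω, (∏ i ∈ Finset.range k, U i (n + i) ω) * W n ω ∂P) atTop
      (𝓝 (∫ ω, (∏ i ∈ Finset.range k, V' i ω) * W' ω ∂P)) := by
  induction k generalizing W W' with
  | zero =>
    simp only [Finset.range_zero, Finset.prod_empty, one_mul]
    exact tendsto_integral_of_dominated_convergence (fun _ => 1)
      (fun n => ((hW n).mono (𝓗.le n)).aestronglyMeasurable) (integrable_const 1)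
      (fun n => Eventually.of_forall (hWb n)) hWlim
  | succ k ih =>
    -- The weight `W` exists for this step: the conditional mean of the last factor, frozen at time
    -- `n`, is known at time `n` and is absorbed into the weight.
    have hVW := ih (W := fun n ω => V k n ω * W n ω) (W' := fun ω => V' k ω * W' ω)
      (fun n => (hV k n).mul (hW n))
      (fun n ω => by
        rw [abs_mul]
        exact mul_le_one₀ (hVb k n ω) (abs_nonneg _) (hWb n ω))
      (by filter_upwards [hlim k, hWlim] with ω h1 h2 using h1.mul h2)
    have hprod : ∀ n, StronglyMeasurable[𝓗 (n + k)]
        fun ω => (∏ i ∈ Finset.range k, U i (n + i) ω) * W n ω := fun n =>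
      (Finset.stronglyMeasurable_fun_prod _ fun i hi => (hU i (n + i)).mono
        (𝓗.mono (by have := Finset.mem_range.1 hi; omega))).mul ((hW n).mono (𝓗.mono (by omega)))
    have hpb : ∀ n ω, |(∏ i ∈ Finset.range k, U i (n + i) ω) * W n ω| ≤ 1 := fun n ω =>
      abs_prod_mul_le_one _ (fun i => hUb i (n + i) ω) (hWb n ω)
    have hUint : ∀ n, Integrable (U k n) P := fun n =>
      Integrable.of_bound ((hU k n).mono (𝓗.le _)).aestronglyMeasurable 1
        (Eventually.of_forall (hUb k n))
    have hVint : ∀ n, Integrable (V k n) P := fun n =>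
      Integrable.of_bound ((hV k n).mono (𝓗.le _)).aestronglyMeasurable 1
        (Eventually.of_forall (hVb k n))
    -- Conditioning at time `n + k` produces `V k (n + k)`. Freezing it as `V k n` is harmless in
    -- the limit, since both converge to `V' k`.
    have hdiff : Tendsto (fun n => ∫ ω, ((∏ i ∈ Finset.range k, U i (n + i) ω) * W n ω)
        * (V k (n + k) ω - V k n ω) ∂P) atTop (𝓝 (∫ _, 0 ∂P)) := by
      refine tendsto_integral_of_dominated_convergence (fun _ => 2)
        (fun n => (((hprod n).mono (𝓗.le _)).mul
          (((hV k (n + k)).mono (𝓗.le _)).sub ((hV k n).mono (𝓗.le _)))).aestronglyMeasurable)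
        (integrable_const 2) (fun n => Eventually.of_forall fun ω => ?_) ?_
      · rw [norm_mul, Real.norm_eq_abs, Real.norm_eq_abs]
        calc _ ≤ 1 * (1 + 1) := mul_le_mul (hpb n ω)
              ((abs_sub _ _).trans (add_le_add (hVb _ _ _) (hVb _ _ _))) (abs_nonneg _) zero_le_one
          _ = 2 := by norm_num
      · filter_upwards [hlim k] with ω hω
        refine squeeze_zero_norm (fun n => ?_)
          (by simpa using ((hω.comp (tendsto_add_atTop_nat k)).sub hω).norm)
        rw [norm_mul]
        exact mul_le_of_le_one_left (norm_nonneg _) (hpb n ω)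
    rw [integral_zero] at hdiff
    have hsum := hdiff.add hVW
    rw [zero_add] at hsum
    simp_rw [Finset.prod_range_succ, mul_assoc]
    refine hsum.congr fun n => ?_
    have hPV : ∀ j, Integrable (fun ω => ((∏ i ∈ Finset.range k, U i (n + i) ω) * W n ω)
        * V k j ω) P := fun j =>
      (hVint j).bdd_mul ((hprod n).mono (𝓗.le _)).aestronglyMeasurable
        (Eventually.of_forall (hpb n))
    have hkey := integral_mul_eq_of_condExp (𝓗.le (n + k)) (hprod n) (hpb n) (hUint (n + k))
      (hUV k (n + k))
    simp_rw [mul_sub]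
    rw [integral_sub (hPV _) (hPV _), ← hkey]
    simp only [mul_assoc, mul_comm, mul_left_comm]
    ring

end ProductLimit

/-! ### Conditional expectation through a conditional law -/

section CondExp

variable {Ω E : Type*} {m mΩ : MeasurableSpace Ω} [mE : MeasurableSpace E] {P : Measure Ω}
  [IsProbabilityMeasure P]

theorem condExp_prodMk_of_condExp (hm : m ≤ mΩ) {Y : Ω → E} (hY : Measurable Y)
    {κ : Ω → ProbabilityMeasure E} (hκ : Measurable[m] κ)
    (h : ∀ B, MeasurableSet B →
      P⟦Y ⁻¹' B | m⟧ =ᵐ[P] fun ω => (κ ω : Measure E).real B)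
    {H : Ω × E → ℝ≥0∞} (hH : Measurable[m.prod mE] H) (hH1 : ∀ p, H p ≤ 1) :
    P[fun ω => (H (ω, Y ω)).toReal | m]
      =ᵐ[P] fun ω => (∫⁻ y, H (ω, y) ∂(κ ω : Measure E)).toReal := by
  have hle : m.prod mE ≤ mΩ.prod mE := sup_le_sup_right (MeasurableSpace.comap_mono hm) _
  have hHY : Measurable fun ω => H (ω, Y ω) :=
    (hH.mono hle le_rfl).comp (measurable_id.prodMk hY)
  have hint1 : ∀ ω, ∫⁻ y, H (ω, y) ∂(κ ω : Measure E) ≤ 1 := fun ω =>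
    (lintegral_mono fun y => hH1 _).trans (by simp)
  have hker : Measurable[m] fun ω => ∫⁻ y, H (ω, y) ∂(κ ω : Measure E) := by
    let K : @Kernel Ω E m mE := @Kernel.mk _ _ m mE (fun ω => (κ ω : Measure E))
      (measurable_subtype_coe.comp hκ)
    have : @IsMarkovKernel _ _ m mE K :=
      @IsMarkovKernel.mk _ _ m mE K
        fun ω => inferInstanceAs (IsProbabilityMeasure (κ ω : Measure E))
    exact @Measurable.lintegral_kernel_prod_right' _ _ m mE K inferInstance H hH
  have hbdd : ∀ {g : Ω → ℝ≥0∞}, Measurable g → (∀ ω, g ω ≤ 1) →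
      Integrable (fun ω => (g ω).toReal) P := fun hg hg1 =>
    Integrable.of_bound hg.ennreal_toReal.aestronglyMeasurable 1 (Eventually.of_forall fun ω => by
      rw [Real.norm_of_nonneg ENNReal.toReal_nonneg]
      exact ENNReal.toReal_le_of_le_ofReal zero_le_one (by simpa using hg1 ω))
  refine (ae_eq_condExp_of_forall_setIntegral_eq hm (hbdd hHY fun ω => hH1 _)
    (fun D _ _ => (hbdd (hker.mono hm le_rfl) hint1).integrableOn) (fun D hD _ => ?_)
    hker.ennreal_toReal.stronglyMeasurable.aestronglyMeasurable).symm
  rw [integral_toReal (hker.mono hm le_rfl).aemeasurable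
      (Eventually.of_forall fun ω => (hint1 ω).trans_lt ENNReal.one_lt_top),
    integral_toReal hHY.aemeasurable
      (Eventually.of_forall fun ω => (hH1 _).trans_lt ENNReal.one_lt_top)]
  congr 1
  have hD1 : Measurable[m.prod mE] fun p : Ω × E => D.indicator (fun _ => (1 : ℝ≥0∞)) p.1 :=
    (measurable_const.indicator hD).comp (@measurable_fst _ _ m mE)
  have hDm : Measurable[m.prod mE] fun p : Ω × E =>
    D.indicator (fun _ => (1 : ℝ≥0∞)) p.1 * H p := hD1.mul hH
  have key := lintegral_prodMk_of_condExp hm hY hκ h hDm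
  have hind : ∀ g : Ω → ℝ≥0∞, (fun ω => D.indicator (fun _ => (1 : ℝ≥0∞)) ω * g ω)
      = D.indicator g := fun g => by
    ext ω; by_cases hω : ω ∈ D <;> simp [hω]
  simp only at key
  rw [hind] at key
  have hin : ∀ ω, ∫⁻ y, D.indicator (fun _ => (1 : ℝ≥0∞)) ω * H (ω, y) ∂(κ ω : Measure E)
      = D.indicator (fun _ => (1 : ℝ≥0∞)) ω * ∫⁻ y, H (ω, y) ∂(κ ω : Measure E) := fun ω =>
    lintegral_const_mul' _ _ (by by_cases hω : ω ∈ D <;> simp [hω])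
  simp_rw [hin] at key
  rw [hind, lintegral_indicator (hm _ hD), lintegral_indicator (hm _ hD)] at key
  exact key.symm

end CondExp

/-! ### Posteriors and mixtures -/

open Classical in
theorem posterior_apply {Θ 𝕏 : Type*} [MeasurableSpace Θ] (f : Θ → 𝕏 → ℝ≥0∞)
    (G : Measure Θ) (x : 𝕏) {A : Set Θ}
    (hA : MeasurableSet A) :
    posterior f G x A = if (∫⁻ t, f t x ∂G) = 0 ∨ (∫⁻ t, f t x ∂G) = ∞ then G A
      else (∫⁻ t, f t x ∂G)⁻¹ * ∫⁻ t in A, f t x ∂G := by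
  unfold posterior
  split_ifs with h
  · rfl
  · rw [Measure.smul_apply, withDensity_apply _ hA, smul_eq_mul]

section Densities

variable {Θ 𝕏 : Type*} [MeasurableSpace Θ] [MeasurableSpace 𝕏] {μ : Measure 𝕏}
  {f : Θ → 𝕏 → ℝ≥0∞}

theorem IsDensityFamily.isProbabilityMeasure_withDensity (hf : IsDensityFamily μ f) (t : Θ) :
    IsProbabilityMeasure (μ.withDensity (f t)) :=
  ⟨by rw [withDensity_apply _ MeasurableSet.univ, Measure.restrict_univ, hf.lintegral_eq_one]⟩

theorem IsDensityFamily.withDensity_le_one (hf : IsDensityFamily μ f) (t : Θ) (B : Set 𝕏) :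
    μ.withDensity (f t) B ≤ 1 :=
  have := hf.isProbabilityMeasure_withDensity t
  prob_le_one

variable [SigmaFinite μ]

theorem measurable_withDensity_apply (hf : Measurable (Function.uncurry f)) {B : Set 𝕏}
    (hB : MeasurableSet B) : Measurable fun t => μ.withDensity (f t) B := by
  simp_rw [withDensity_apply _ hB]
  exact Measurable.lintegral_prod_right' hf

theorem mixture_apply (hf : Measurable (Function.uncurry f)) (G : Measure Θ) [SFinite G]
    {B : Set 𝕏} (hB : MeasurableSet B) :
    mixture μ f G B = ∫⁻ t, μ.withDensity (f t) B ∂G := by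
  rw [mixture, withDensity_apply _ hB, lintegral_lintegral_swap
    (f := fun x t => f t x) (hf.comp measurable_swap).aemeasurable]
  simp_rw [withDensity_apply _ hB]

theorem IsDensityFamily.isProbabilityMeasure_mixture (hf : IsDensityFamily μ f) (G : Measure Θ)
    [IsProbabilityMeasure G] : IsProbabilityMeasure (mixture μ f G) := by
  refine ⟨?_⟩
  rw [mixture_apply hf.measurable G MeasurableSet.univ]
  have := hf.isProbabilityMeasure_withDensity
  simp

/-- The mixture, as a probability measure. -/
noncomputable def mixtureLaw (hf : IsDensityFamily μ f) (G : ProbabilityMeasure Θ) :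
    ProbabilityMeasure 𝕏 :=
  ⟨mixture μ f G, hf.isProbabilityMeasure_mixture G⟩

theorem measurable_mixtureLaw (hf : IsDensityFamily μ f) : Measurable (mixtureLaw hf) := by
  refine Measurable.subtype_mk (Measure.measurable_of_measurable_coe _ fun B hB => ?_)
  simp_rw [mixture_apply hf.measurable _ hB]
  exact (Measure.measurable_lintegral (measurable_withDensity_apply hf.measurable hB)).comp
    measurable_subtype_coe

theorem measurable_posterior_apply {Ω : Type*} [MeasurableSpace Ω]
    (hf : Measurable (Function.uncurry f)) {κ : Ω → ProbabilityMeasure Θ} (hκ : Measurable κ)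
    {A : Set Θ} (hA : MeasurableSet A) :
    Measurable fun p : Ω × 𝕏 => posterior f (κ p.1 : Measure Θ) p.2 A := by
  classical
  let K : Kernel (Ω × 𝕏) Θ := ⟨fun p => (κ p.1 : Measure Θ),
    measurable_subtype_coe.comp (hκ.comp measurable_fst)⟩
  have : IsMarkovKernel K := ⟨fun p => inferInstanceAs (IsProbabilityMeasure (κ p.1 : Measure Θ))⟩
  have hfm : Measurable fun q : (Ω × 𝕏) × Θ => f q.2 q.1.2 :=
    hf.comp (measurable_snd.prodMk (measurable_snd.comp measurable_fst))
  have hZ : ∀ A, MeasurableSet A →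
      Measurable fun p : Ω × 𝕏 => ∫⁻ t in A, f t p.2 ∂(κ p.1 : Measure Θ) := fun A hA => by
    have : Measurable fun q : (Ω × 𝕏) × Θ => A.indicator (fun t => f t q.1.2) q.2 :=
      Measurable.ite (measurable_snd hA) hfm measurable_const
    simp_rw [← lintegral_indicator hA]
    exact Measurable.lintegral_kernel_prod_right' (κ := K) this
  have hZu : Measurable fun p : Ω × 𝕏 => ∫⁻ t, f t p.2 ∂(κ p.1 : Measure Θ) := by
    simpa using hZ Set.univ MeasurableSet.univ
  simp_rw [posterior_apply _ _ _ hA]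
  exact Measurable.ite ((hZu (measurableSet_singleton 0)).union (hZu (measurableSet_singleton ∞)))
    (measurable_coe_apply (hκ.comp measurable_fst) hA) (hZu.inv.mul (hZ A hA))

/-- The prior is the mean of the posterior, when the observation follows the mixture. -/
theorem lintegral_posterior (hf : IsDensityFamily μ f) (G : ProbabilityMeasure Θ) {A : Set Θ}
    (hA : MeasurableSet A) :
    ∫⁻ x, posterior f (G : Measure Θ) x A ∂(mixture μ f G) = (G : Measure Θ) A := by
  classical
  have hsw : ∀ A, MeasurableSet A →
      ∫⁻ x, ∫⁻ t in A, f t x ∂(G : Measure Θ) ∂μ = (G : Measure Θ) A := fun A hA => by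
    rw [lintegral_lintegral_swap (f := fun x t => f t x)
      (hf.measurable.comp measurable_swap).aemeasurable]
    simp [hf.lintegral_eq_one]
  have hZm : Measurable fun x => ∫⁻ t, f t x ∂(G : Measure Θ) :=
    Measurable.lintegral_prod_left' hf.measurable
  have hZ : ∫⁻ x, ∫⁻ t, f t x ∂(G : Measure Θ) ∂μ = 1 := by
    simpa using hsw Set.univ MeasurableSet.univ
  have hpm : Measurable fun x => posterior f (G : Measure Θ) x A :=
    (measurable_posterior_apply (Ω := Unit) hf.measurable (κ := fun _ => G) measurable_const hA).comp
      (measurable_const (a := ())|>.prodMk measurable_id)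
  rw [mixture, lintegral_withDensity_eq_lintegral_mul _ hZm hpm, ← hsw A hA]
  refine lintegral_congr_ae ?_
  -- The convention in `posterior` does no harm: the normalising constant integrates to 1, so it is
  -- finite `μ`-almost everywhere, and where it vanishes the numerator vanishes too.
  filter_upwards [ae_lt_top hZm (by rw [hZ]; simp)] with x hx
  rw [Pi.mul_apply, posterior_apply _ _ _ hA]
  by_cases h0 : (∫⁻ t, f t x ∂(G : Measure Θ)) = 0
  · have : ∫⁻ t in A, f t x ∂(G : Measure Θ) = 0 :=
      le_antisymm ((setLIntegral_le_lintegral A _).trans h0.le) zero_le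
    rw [h0, this, zero_mul]
  · rw [if_neg (by simp [h0, hx.ne]), ← mul_assoc, ENNReal.mul_inv_cancel h0 hx.ne, one_mul]

end Densities

/-! ### From setwise to weak convergence -/

section WeakLimit

/-- Finite intersections from a countable basis. Countability lets the null sets attached to the
individual sets be united. -/
theorem exists_countable_isPiSystem_nhds (E : Type*) [TopologicalSpace E]
    [SecondCountableTopology E] : ∃ S : Set (Set E), S.Countable ∧ IsPiSystem S ∧
      (∀ s ∈ S, IsOpen s) ∧ ∀ u, IsOpen u → ∀ x ∈ u, ∃ s ∈ S, s ∈ 𝓝 x ∧ s ⊆ u := by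
  obtain ⟨b, hbc, -, hb⟩ := TopologicalSpace.exists_countable_basis E
  refine ⟨(fun F : Set (Set E) => ⋂₀ F) '' {F | F.Finite ∧ F ⊆ b},
    (Set.countable_ofPred_finite_subset hbc).image _, ?_, ?_, ?_⟩
  · rintro _ ⟨F, hF, rfl⟩ _ ⟨F', hF', rfl⟩ -
    exact ⟨F ∪ F', ⟨hF.1.union hF'.1, Set.union_subset hF.2 hF'.2⟩, Set.sInter_union F F'⟩
  · rintro _ ⟨F, hF, rfl⟩
    exact hF.1.isOpen_sInter fun s hs => hb.isOpen (hF.2 hs)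
  · intro u hu x hx
    obtain ⟨s, hs, hxs, hsu⟩ := hb.exists_subset_of_mem_open hx hu
    exact ⟨s, ⟨{s}, ⟨Set.finite_singleton s, Set.singleton_subset_iff.2 hs⟩,
      Set.sInter_singleton s⟩, (hb.isOpen hs).mem_nhds hxs, hsu⟩

theorem tendsto_probabilityMeasure_apply {ι E : Type*} [MeasurableSpace E] {l : Filter ι}
    {κ : ι → ProbabilityMeasure E} {G : ProbabilityMeasure E} {A : Set E}
    (h : Tendsto (fun n => (κ n : Measure E) A) l (𝓝 ((G : Measure E) A))) :
    Tendsto (fun n => κ n A) l (𝓝 (G A)) :=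
  (ENNReal.tendsto_toNNReal (measure_ne_top _ _)).comp h

/-- Almost sure convergence on each measurable set implies almost sure weak convergence. -/
theorem ae_tendsto_of_forall_measurableSet {Ω E : Type*} [MeasurableSpace Ω] {P : Measure Ω}
    [TopologicalSpace E] [SecondCountableTopology E] [MeasurableSpace E] [OpensMeasurableSpace E]
    {κ : ℕ → Ω → ProbabilityMeasure E} {G : Ω → ProbabilityMeasure E}
    (h : ∀ A, MeasurableSet A →
      ∀ᵐ ω ∂P, Tendsto (fun n => (κ n ω : Measure E) A) atTop (𝓝 ((G ω : Measure E) A))) :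
    ∀ᵐ ω ∂P, Tendsto (fun n => κ n ω) atTop (𝓝 (G ω)) := by
  obtain ⟨S, hSc, hSpi, hSo, hSn⟩ := exists_countable_isPiSystem_nhds E
  have hall : ∀ᵐ ω ∂P, ∀ s ∈ S,
      Tendsto (fun n => (κ n ω : Measure E) s) atTop (𝓝 ((G ω : Measure E) s)) :=
    (ae_ball_iff hSc).2 fun s hs => h s (hSo s hs).measurableSet
  filter_upwards [hall] with ω hω
  exact hSpi.tendsto_probabilityMeasure_of_tendsto_of_mem (fun s hs => (hSo s hs).measurableSet)
    hSn fun s hs => tendsto_probabilityMeasure_apply (hω s hs)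

theorem ae_tendsto_integral_of_continuous {Ω E : Type*} [MeasurableSpace Ω]
    {P : Measure Ω} [TopologicalSpace E] [SecondCountableTopology E] [MeasurableSpace E]
    [OpensMeasurableSpace E] {κ : ℕ → Ω → ProbabilityMeasure E} {G : Ω → ProbabilityMeasure E}
    (h : ∀ A, MeasurableSet A →
      ∀ᵐ ω ∂P, Tendsto (fun n => (κ n ω : Measure E) A) atTop (𝓝 ((G ω : Measure E) A)))
    {g : E → ℝ} (hg : Continuous g) {C : ℝ} (hC : ∀ t, |g t| ≤ C) :
    ∀ᵐ ω ∂P, Tendsto (fun n => ∫ t, g t ∂(κ n ω : Measure E)) atTop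
      (𝓝 (∫ t, g t ∂(G ω : Measure E))) := by
  filter_upwards [ae_tendsto_of_forall_measurableSet h] with ω hω
  exact ProbabilityMeasure.tendsto_iff_forall_integral_tendsto.1 hω
    (BoundedContinuousFunction.ofNormedAddCommGroup g hg C hC)

/-- Almost sure convergence on each measurable set implies almost sure convergence of the integrals
of a bounded measurable function: it is continuous for a finer topology with the same Borel sets. -/
theorem ae_tendsto_integral_of_measurable {Ω E : Type*} [MeasurableSpace Ω]
    {P : Measure Ω} [MeasurableSpace E] [StandardBorelSpace E]
    {κ : ℕ → Ω → ProbabilityMeasure E} {G : Ω → ProbabilityMeasure E}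
    (h : ∀ A, MeasurableSet A →
      ∀ᵐ ω ∂P, Tendsto (fun n => (κ n ω : Measure E) A) atTop (𝓝 ((G ω : Measure E) A)))
    {g : E → ℝ} (hg : Measurable g) {C : ℝ} (hC : ∀ t, |g t| ≤ C) :
    ∀ᵐ ω ∂P, Tendsto (fun n => ∫ t, g t ∂(κ n ω : Measure E)) atTop
      (𝓝 (∫ t, g t ∂(G ω : Measure E))) := by
  obtain ⟨τ, hτb, hτp⟩ := StandardBorelSpace.polish (α := E)
  obtain ⟨τ', hle, hgc, hτ'p⟩ := hg.exists_continuous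
  have hb : @BorelSpace E τ' _ :=
    @BorelSpace.mk E τ' _ (hτb.measurable_eq.trans (borel_eq_borel_of_le hτ'p hτp hle).symm)
  exact @ae_tendsto_integral_of_continuous Ω E _ P τ' hτ'p.toSecondCountableTopology _
    (@BorelSpace.opensMeasurable E τ' _ hb) κ G h g hgc C hC

end WeakLimit

/-! ### The martingale property of Newton's rule -/

section Newton

variable {Ω Θ 𝕏 : Type*} [MeasurableSpace Θ] {f : Θ → 𝕏 → ℝ≥0∞} {α : ℕ → ℝ}
  {hα : ∀ n, α n ∈ Set.Ioo (0 : ℝ) 1} {G₀ : ProbabilityMeasure Θ}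

variable [MeasurableSpace 𝕏]

/-- The σ-field on `Ω` is arbitrary and only the first `n` observations are assumed measurable, so
the statement also applies to the σ-field of the past and yields adaptedness. -/
theorem measurable_newtonRule [MeasurableSpace Ω] (hf : Measurable (Function.uncurry f))
    {X : ℕ → Ω → 𝕏} {n : ℕ} (hX : ∀ i < n, Measurable (X i)) :
    Measurable fun ω => newtonRule α hα f G₀ n fun i => X i ω := by
  induction n with
  | zero => exact measurable_const (a := G₀)
  | succ n ih =>
    have ih' := ih fun i hi => hX i (by omega)
    refine Measurable.subtype_mk (Measure.measurable_of_measurable_coe _ fun A hA => ?_)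
    exact ((measurable_coe_apply ih' hA).const_mul _).add
      (((measurable_posterior_apply hf ih' hA).comp
        (measurable_id.prodMk (hX n n.lt_succ_self))).const_mul _)

variable {mΩ : MeasurableSpace Ω}

/-- The observations are adapted to a filtration, and the next one follows the mixture under
the current state of Newton's rule. -/
structure IsMixturePredictive (P : Measure Ω) (𝓗 : Filtration ℕ mΩ) (X : ℕ → Ω → 𝕏)
    (μ : Measure 𝕏) (f : Θ → 𝕏 → ℝ≥0∞) (α : ℕ → ℝ) (hα : ∀ n, α n ∈ Set.Ioo (0 : ℝ) 1)
    (G₀ : ProbabilityMeasure Θ) : Prop where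
  adapted : ∀ n, Measurable[𝓗 (n + 1)] (X n)
  obs_law : ∀ (n : ℕ) (B : Set 𝕏), MeasurableSet B →
    P⟦X n ⁻¹' B | 𝓗 n⟧
      =ᵐ[P] fun ω => (mixture μ f (newtonRule α hα f G₀ n fun i => X i ω : Measure Θ)).real B

namespace IsMixturePredictive

variable {P : Measure Ω} {𝓗 : Filtration ℕ mΩ} {X : ℕ → Ω → 𝕏} {μ : Measure 𝕏}

theorem measurable_newtonRule (h : IsMixturePredictive P 𝓗 X μ f α hα G₀)
    (hf : IsDensityFamily μ f) (n : ℕ) :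
    Measurable[𝓗 n] fun ω => newtonRule α hα f G₀ n fun i => X i ω :=
  @NewtonRule.measurable_newtonRule _ _ _ _ _ _ _ _ _ (𝓗 n) hf.measurable _ _
    fun i hi => (h.adapted i).mono (𝓗.mono hi) le_rfl

variable [IsProbabilityMeasure P] [SigmaFinite μ]

/-- Integrating the posterior over the next observation, whose law is the mixture under `G_n`, gives
back `G_n` by `lintegral_posterior`; the weights `1 - α n` and `α n` add up to 1. -/
theorem condExp_newtonRule (h : IsMixturePredictive P 𝓗 X μ f α hα G₀)
    (hf : IsDensityFamily μ f) (n : ℕ) {A : Set Θ} (hA : MeasurableSet A) :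
    P[fun ω => (newtonRule α hα f G₀ (n + 1) fun i => X i ω : Measure Θ).real A | 𝓗 n]
      =ᵐ[P] fun ω => (newtonRule α hα f G₀ n fun i => X i ω : Measure Θ).real A := by
  have hG := h.measurable_newtonRule hf n
  have hX : Measurable (X n) := (h.adapted n).mono (𝓗.le _) le_rfl
  have hα0 : 0 ≤ 1 - α n := sub_nonneg.2 (hα n).2.le
  have hsum : ENNReal.ofReal (1 - α n) + ENNReal.ofReal (α n) = 1 := by
    rw [← ENNReal.ofReal_add hα0 (hα n).1.le]; simp
  let H : Ω × 𝕏 → ℝ≥0∞ := fun p =>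
    ENNReal.ofReal (1 - α n) * (newtonRule α hα f G₀ n fun i => X i p.1 : Measure Θ) A
      + ENNReal.ofReal (α n)
        * posterior f (newtonRule α hα f G₀ n fun i => X i p.1 : Measure Θ) p.2 A
  have hpost := @measurable_posterior_apply _ _ _ _ _ _ (𝓗 n) hf.measurable _ hG A hA
  have hG1 : Measurable[(𝓗 n).prod inferInstance] fun p : Ω × 𝕏 =>
      (newtonRule α hα f G₀ n fun i => X i p.1 : Measure Θ) A :=
    (@measurable_coe_apply _ _ _ (𝓗 n) _ hG A hA).comp (@measurable_fst _ _ (𝓗 n) _)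
  have hH : Measurable[(𝓗 n).prod inferInstance] H := (hG1.const_mul _).add (hpost.const_mul _)
  have key := condExp_prodMk_of_condExp (𝓗.le n) hX
    (κ := fun ω => mixtureLaw hf (newtonRule α hα f G₀ n fun i => X i ω))
    ((measurable_mixtureLaw hf).comp hG) (h.obs_law n) hH fun p => by
      have := isProbabilityMeasure_posterior f
        (newtonRule α hα f G₀ n fun i => X i p.1 : Measure Θ) p.2
      refine (add_le_add (mul_le_mul' le_rfl prob_le_one) (mul_le_mul' le_rfl prob_le_one)).trans ?_
      rw [mul_one, mul_one, hsum]
  refine key.trans (Eventually.of_forall fun ω => ?_)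
  have hpx : Measurable fun x =>
      posterior f (newtonRule α hα f G₀ n fun i => X i ω : Measure Θ) x A :=
    hpost.comp (@measurable_prodMk_left _ _ (𝓗 n) _ ω)
  change (∫⁻ x, H (ω, x) ∂(mixture μ f _)).toReal = _
  have := hf.isProbabilityMeasure_mixture (newtonRule α hα f G₀ n fun i => X i ω : Measure Θ)
  simp only [H]
  rw [lintegral_add_left measurable_const, lintegral_const, measure_univ, mul_one,
    lintegral_const_mul _ hpx, lintegral_posterior hf _ hA, ← add_mul, hsum, one_mul,
    measureReal_def]

theorem martingale_newtonRule (h : IsMixturePredictive P 𝓗 X μ f α hα G₀)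
    (hf : IsDensityFamily μ f) {A : Set Θ} (hA : MeasurableSet A) :
    Martingale (fun n ω => (newtonRule α hα f G₀ n fun i => X i ω : Measure Θ).real A) 𝓗 P := by
  have hmeas : ∀ n, Measurable[𝓗 n]
      fun ω => (newtonRule α hα f G₀ n fun i => X i ω : Measure Θ).real A := fun n =>
    (@measurable_coe_apply _ _ _ (𝓗 n) _ (h.measurable_newtonRule hf n) A hA).ennreal_toReal
  refine martingale_nat (fun n => (hmeas n).stronglyMeasurable) (fun n => ?_)
    fun n => (h.condExp_newtonRule hf n hA).symm
  exact Integrable.of_bound ((hmeas n).mono (𝓗.le n) le_rfl).aestronglyMeasurable 1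
    (Eventually.of_forall fun ω => by
      rw [Real.norm_of_nonneg measureReal_nonneg]; exact measureReal_le_one)

/-- Bounded martingales have constant expectation and converge almost surely. -/
theorem convergesSetwise (h : IsMixturePredictive P 𝓗 X μ f α hα G₀)
    (hf : IsDensityFamily μ f) :
    ConvergesSetwise P (fun n ω => newtonRule α hα f G₀ n fun i => X i ω) G₀ where
  measurable n := (h.measurable_newtonRule hf n).mono (𝓗.le n) le_rfl
  mean n A hA := by
    have hM := h.martingale_newtonRule hf hA
    have h1 : ∫ ω, (newtonRule α hα f G₀ n fun i => X i ω : Measure Θ).real A ∂P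
        = (G₀ : Measure Θ).real A := by
      rw [← setIntegral_univ, ← hM.setIntegral_eq (Nat.zero_le n) MeasurableSet.univ]
      simp [newtonRule, newtonMeasure]
    rw [← ofReal_measureReal (μ := (G₀ : Measure Θ)), ← h1,
      ofReal_integral_eq_lintegral_ofReal (hM.integrable n)
        (Eventually.of_forall fun ω => measureReal_nonneg)]
    simp
  exists_tendsto A hA := by
    have hM := h.martingale_newtonRule hf hA
    have := hM.submartingale.exists_ae_tendsto_of_bdd (R := 1) fun n => by
      refine (eLpNorm_le_of_ae_bound (C := 1) (Eventually.of_forall fun ω => ?_)).trans (by simp)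
      rw [Real.norm_of_nonneg measureReal_nonneg]
      exact measureReal_le_one
    filter_upwards [this] with ω ⟨c, hc⟩
    exact ⟨ENNReal.ofReal c, by simpa using ENNReal.tendsto_ofReal hc⟩

end IsMixturePredictive

end Newton

/-! ### Identifiability as density in L² -/

section Identifiability

variable {Θ 𝕏 : Type*} [MeasurableSpace Θ] [MeasurableSpace 𝕏] {μ : Measure 𝕏} [SigmaFinite μ]
  {f : Θ → 𝕏 → ℝ≥0∞}

/-- Taking `B = Set.univ` shows that the total masses agree, so both measures can be normalised by
the same constant. -/
theorem Identifiable.eq_of_lintegral_eq (hident : Identifiable μ f) (hf : IsDensityFamily μ f)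
    {ν ν' : Measure Θ} [IsFiniteMeasure ν] [IsFiniteMeasure ν']
    (h : ∀ B, MeasurableSet B →
      ∫⁻ t, μ.withDensity (f t) B ∂ν = ∫⁻ t, μ.withDensity (f t) B ∂ν') : ν = ν' := by
  have hprob := hf.isProbabilityMeasure_withDensity
  have huniv : ν Set.univ = ν' Set.univ := by simpa using h Set.univ MeasurableSet.univ
  by_cases h0 : ν Set.univ = 0
  · rw [Measure.measure_univ_eq_zero.1 h0, Measure.measure_univ_eq_zero.1 (huniv.symm.trans h0)]
  have hfin := measure_ne_top ν Set.univ
  have hinv : (ν Set.univ)⁻¹ * ν Set.univ = 1 := ENNReal.inv_mul_cancel h0 hfin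
  let G : ProbabilityMeasure Θ := ⟨(ν Set.univ)⁻¹ • ν, ⟨by simpa using hinv⟩⟩
  let G' : ProbabilityMeasure Θ := ⟨(ν Set.univ)⁻¹ • ν', ⟨by simpa [← huniv] using hinv⟩⟩
  have hGG : G = G' := hident G G' <| Measure.ext fun B hB => by
    rw [mixture_apply hf.measurable _ hB, mixture_apply hf.measurable _ hB]
    simp only [G, G', ProbabilityMeasure.coe_mk, lintegral_smul_measure, h B hB]
  have hs : (ν Set.univ)⁻¹ • ν = (ν Set.univ)⁻¹ • ν' := congrArg Subtype.val hGG
  have := congrArg (fun ρ : Measure Θ => ν Set.univ • ρ) hs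
  simpa [smul_smul, ENNReal.mul_inv_cancel h0 hfin] using this

/-- The measures with `G`-densities `v⁺` and `v⁻` have the same mixtures, hence coincide. So `v⁺ =
v⁻` almost everywhere, and since one of them is zero at each point, both vanish. -/
theorem Identifiable.ae_eq_zero (hident : Identifiable μ f) (hf : IsDensityFamily μ f)
    {G : Measure Θ} [IsFiniteMeasure G] {v : Θ → ℝ} (hv : Measurable v) (hvi : Integrable v G)
    (h : ∀ B, MeasurableSet B → ∫ t, (μ.withDensity (f t)).real B * v t ∂G = 0) :
    v =ᵐ[G] 0 := by
  have hfin : ∀ {w : Θ → ℝ}, Integrable w G → ∫⁻ t, ENNReal.ofReal (w t) ∂G ≠ ∞ :=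
    fun hw => hw.lintegral_lt_top.ne
  have := isFiniteMeasure_withDensity (hfin hvi)
  have := isFiniteMeasure_withDensity (hfin hvi.neg)
  have heq : G.withDensity (fun t => ENNReal.ofReal (v t))
      = G.withDensity fun t => ENNReal.ofReal ((-v) t) := by
    refine hident.eq_of_lintegral_eq hf fun B hB => ?_
    have hp := measurable_withDensity_apply (μ := μ) hf.measurable hB
    have hreal : ∀ t, ENNReal.ofReal ((μ.withDensity (f t)).real B) = μ.withDensity (f t) B :=
      fun t => ENNReal.ofReal_toReal (ne_top_of_le_ne_top ENNReal.one_ne_top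
        (hf.withDensity_le_one t B))
    have hint : Integrable (fun t => (μ.withDensity (f t)).real B * v t) G :=
      hvi.bdd_mul (c := 1) hp.ennreal_toReal.aestronglyMeasurable (Eventually.of_forall fun t => by
        have := hf.isProbabilityMeasure_withDensity t
        rw [Real.norm_of_nonneg measureReal_nonneg]
        exact measureReal_le_one)
    have hneg : ∫⁻ t, ENNReal.ofReal (-((μ.withDensity (f t)).real B * v t)) ∂G ≠ ∞ :=
      hfin hint.neg
    have key := h B hB
    rw [integral_eq_lintegral_pos_part_sub_lintegral_neg_part hint, sub_eq_zero,
      ENNReal.toReal_eq_toReal_iff' (hfin hint) hneg] at key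
    simp_rw [← mul_neg, ENNReal.ofReal_mul measureReal_nonneg, hreal] at key
    rw [lintegral_withDensity_eq_lintegral_mul _ hv.ennreal_ofReal hp,
      lintegral_withDensity_eq_lintegral_mul _ hv.neg.ennreal_ofReal hp]
    simpa only [Pi.mul_apply, mul_comm, Pi.neg_apply] using key
  have hae := (withDensity_eq_iff hv.ennreal_ofReal.aemeasurable
    hv.neg.ennreal_ofReal.aemeasurable (hfin hvi)).1 heq
  filter_upwards [hae] with t ht
  rcases le_total 0 (v t) with h0 | h0
  · have : ENNReal.ofReal ((-v) t) = 0 := ENNReal.ofReal_of_nonpos (by simpa using h0)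
    rw [this, ENNReal.ofReal_eq_zero] at ht
    exact le_antisymm ht h0
  · rw [ENNReal.ofReal_of_nonpos h0, eq_comm, ENNReal.ofReal_eq_zero] at ht
    exact le_antisymm h0 (by simpa using ht)

/-- If the mixture is identifiable, the functions `t ↦ F_t(B)` span a dense space of functions:
a space of bounded functions that contains them and is closed in mean contains all bounded
measurable functions. -/
theorem Identifiable.mem_submodule (hident : Identifiable μ f) (hf : IsDensityFamily μ f)
    (G : Measure Θ) [IsProbabilityMeasure G] (S : Submodule ℝ (Θ → ℝ))
    (hS : ∀ s ∈ S, Measurable s ∧ ∃ C, ∀ t, |s t| ≤ C)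
    (hmem : ∀ B, MeasurableSet B → (fun t => (μ.withDensity (f t)).real B) ∈ S)
    (hclosed : ∀ g : Θ → ℝ, Measurable g → (∃ C, ∀ t, |g t| ≤ C) →
      (∀ ε > 0, ∃ s ∈ S, ∫ t, |g t - s t| ∂G ≤ ε) → g ∈ S)
    {g : Θ → ℝ} (hg : Measurable g) (hgb : ∃ C, ∀ t, |g t| ≤ C) : g ∈ S := by
  have hL2 : ∀ {s : Θ → ℝ}, Measurable s → (∃ C, ∀ t, |s t| ≤ C) → MemLp s 2 G := fun hs hC => by
    obtain ⟨C, hC⟩ := hC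
    exact MemLp.of_bound hs.aestronglyMeasurable C (Eventually.of_forall hC)
  have hSL : ∀ s : S, MemLp (s : Θ → ℝ) 2 G := fun s => hL2 (hS s s.2).1 (hS s s.2).2
  let T : S →ₗ[ℝ] Lp ℝ 2 G :=
    { toFun := fun s => (hSL s).toLp
      map_add' := fun s s' => MemLp.toLp_add (hSL s) (hSL s')
      map_smul' := fun c s => MemLp.toLp_const_smul c (hSL s) }
  have hdense : (LinearMap.range T).topologicalClosure = ⊤ := by
    rw [Submodule.topologicalClosure_eq_top_iff, Submodule.eq_bot_iff]
    intro v hv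
    have hvL : MemLp v 2 G := Lp.memLp v
    have hv0 : (v : Θ → ℝ) =ᵐ[G] 0 := by
      refine hident.ae_eq_zero hf (Lp.stronglyMeasurable v).measurable
        (hvL.integrable (by norm_num)) fun B hB => ?_
      have h1 := (Submodule.mem_orthogonal _ v).1 hv _ ⟨⟨_, hmem B hB⟩, rfl⟩
      rw [L2.inner_def] at h1
      rw [← h1]
      refine integral_congr_ae ?_
      filter_upwards [(hSL ⟨_, hmem B hB⟩).coeFn_toLp] with t ht
      simp only [T, LinearMap.coe_mk, AddHom.coe_mk, ht]
      simp [mul_comm]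
    exact Lp.eq_zero_iff_ae_eq_zero.2 hv0
  -- Approximation in L² is approximation in mean, since the L¹ norm is at most the L² norm under a
  -- probability measure.
  refine hclosed g hg hgb fun ε hε => ?_
  have hgL := hL2 hg hgb
  have hcl : hgL.toLp ∈ closure (LinearMap.range T : Set (Lp ℝ 2 G)) := by
    rw [← Submodule.topologicalClosure_coe, hdense]; trivial
  obtain ⟨_, ⟨s, rfl⟩, hs⟩ := Metric.mem_closure_iff.1 hcl ε hε
  refine ⟨s, s.2, ?_⟩
  have hd : MemLp (fun t => g t - (s : Θ → ℝ) t) 2 G := hgL.sub (hSL s)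
  have hdist : dist hgL.toLp (T s) = (eLpNorm (fun t => g t - (s : Θ → ℝ) t) 2 G).toReal := by
    rw [dist_eq_norm]
    change ‖hgL.toLp - (hSL s).toLp‖ = _
    rw [← MemLp.toLp_sub, Lp.norm_toLp]
    rfl
  have h1 : ∫ t, |g t - (s : Θ → ℝ) t| ∂G
      = (eLpNorm (fun t => g t - (s : Θ → ℝ) t) 1 G).toReal := by
    rw [eLpNorm_one_eq_lintegral_enorm, ← integral_norm_eq_lintegral_enorm hd.1]
    rfl
  rw [h1]
  refine (ENNReal.toReal_mono hd.eLpNorm_ne_top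
    (eLpNorm_le_eLpNorm_of_exponent_le (by norm_num) hd.1)).trans ?_
  rw [← hdist]
  exact hs.le

end Identifiability

/-! ### Filtrations of the past -/

section Filtrations

variable {Ω E : Type*} [MeasurableSpace E]

theorem pastField_mono (Y : ℕ → Ω → E) : Monotone (pastField Y) := fun _ _ h =>
  iSup_le fun i => le_iSup_of_le (Fin.castLE h i) le_rfl

theorem pastField_le_fullField (Y : ℕ → Ω → E) (n : ℕ) : pastField Y n ≤ fullField Y :=
  iSup_le fun i => le_iSup (fun j : ℕ => MeasurableSpace.comap (Y j) inferInstance) i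

theorem measurable_pastField (Y : ℕ → Ω → E) {i n : ℕ} (h : i < n) :
    Measurable[pastField Y n] (Y i) :=
  Measurable.of_comap_le (le_iSup (fun j : Fin n => MeasurableSpace.comap (Y j) inferInstance)
    ⟨i, h⟩)

theorem measurable_fullField (Y : ℕ → Ω → E) (i : ℕ) : Measurable[fullField Y] (Y i) :=
  Measurable.of_comap_le (le_iSup (fun j : ℕ => MeasurableSpace.comap (Y j) inferInstance) i)

variable [mΩ : MeasurableSpace Ω]

theorem fullField_le {Y : ℕ → Ω → E} (hY : ∀ n, Measurable (Y n)) : fullField Y ≤ mΩ :=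
  iSup_le fun i => (hY i).comap_le

/-- The filtration generated by a sequence of random elements. -/
def pastFiltration {Y : ℕ → Ω → E} (hY : ∀ n, Measurable (Y n)) : Filtration ℕ mΩ where
  seq := pastField Y
  mono' := pastField_mono Y
  le' n := (pastField_le_fullField Y n).trans (fullField_le hY)

end Filtrations

/-! ### Predictive laws in the two schemes -/

section Models

variable {Ω Θ 𝕏 : Type*} [mΩ : MeasurableSpace Ω] [MeasurableSpace Θ] [MeasurableSpace 𝕏]
  {P : Measure Ω} [IsProbabilityMeasure P] {X : ℕ → Ω → 𝕏} {θ : ℕ → Ω → Θ} {μ : Measure 𝕏}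
  [SigmaFinite μ] {f : Θ → 𝕏 → ℝ≥0∞} {α : ℕ → ℝ} {hα : ∀ n, α n ∈ Set.Ioo (0 : ℝ) 1}
  {G₀ : ProbabilityMeasure Θ}

/-- Tower property: condition first on `m'`, which yields the density at the latent variable, then
average over the law of that variable given `m`. -/
theorem condExp_obs_of_latent (hf : IsDensityFamily μ f) {m m' : MeasurableSpace Ω} (hm : m ≤ m')
    (hm' : m' ≤ mΩ) {x : Ω → 𝕏} {t : Ω → Θ} (ht : Measurable[mΩ] t)
    {κ : Ω → ProbabilityMeasure Θ} (hκ : Measurable[m] κ) {B : Set 𝕏} (hB : MeasurableSet B)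
    (hobs : P⟦x ⁻¹' B | m'⟧ =ᵐ[P] fun ω => (μ.withDensity (f (t ω))).real B)
    (hlat : ∀ A, MeasurableSet A →
      P⟦t ⁻¹' A | m⟧ =ᵐ[P] fun ω => (κ ω : Measure Θ).real A) :
    P⟦x ⁻¹' B | m⟧ =ᵐ[P] fun ω => (mixture μ f (κ ω : Measure Θ)).real B := by
  have hH : Measurable[m.prod inferInstance] fun p : Ω × Θ => μ.withDensity (f p.2) B :=
    (measurable_withDensity_apply hf.measurable hB).comp (@measurable_snd _ _ m _)
  refine (condExp_condExp_of_le hm hm').symm.trans ((condExp_congr_ae hobs).trans ?_)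
  refine (condExp_prodMk_of_condExp (hm.trans hm') ht hκ hlat hH
    fun p => hf.withDensity_le_one _ _).trans (Eventually.of_forall fun ω => ?_)
  simp only
  rw [measureReal_def, mixture_apply hf.measurable _ hB]

/-- The filtration contains the past latent variables, so that `θ` itself is adapted with predictive
laws `G_n`. -/
theorem IsSequentialNewtonModel.isMixturePredictive
    (h : IsSequentialNewtonModel P X θ μ f α hα G₀) (hf : IsDensityFamily μ f) :
    IsMixturePredictive P (pastFiltration h.measurable_obs ⊔ pastFiltration h.measurable_latent)
      X μ f α hα G₀ where
  adapted n := (measurable_pastField X n.lt_succ_self).mono le_sup_left le_rfl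
  obs_law n B hB := by
    refine condExp_obs_of_latent hf (sup_le_sup_left (pastField_mono θ n.le_succ) _)
      (sup_le ((pastFiltration h.measurable_obs).le n)
        ((pastFiltration h.measurable_latent).le (n + 1))) (h.measurable_latent n) ?_ hB
      (h.obs_law n B hB) (h.latent_law n)
    exact (@measurable_newtonRule _ _ _ _ _ _ _ _ _ (pastField X n) hf.measurable _ _
      fun i hi => measurable_pastField X hi).mono le_sup_left le_rfl

/-- Here the law of `θ n` is specified only given the observations, so the filtration is theirs
alone. -/
theorem IsNewtonModel.isMixturePredictive
    (h : IsNewtonModel P X θ μ f α hα G₀) (hf : IsDensityFamily μ f) :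
    IsMixturePredictive P (pastFiltration h.measurable_obs) X μ f α hα G₀ where
  adapted n := measurable_pastField X n.lt_succ_self
  obs_law n B hB := by
    refine condExp_obs_of_latent hf le_sup_left
      (sup_le ((pastFiltration h.measurable_obs).le n) (fullField_le h.measurable_latent))
      (h.measurable_latent n) ?_ hB (h.obs_law n B hB) (h.latent_law n)
    exact @measurable_newtonRule _ _ _ _ _ _ _ _ _ (pastField X n) hf.measurable _ _
      fun i hi => measurable_pastField X hi

theorem abs_indicator_one_le_one {E : Type*} (A : Set E) (t : E) :
    |A.indicator (fun _ => (1 : ℝ)) t| ≤ 1 := by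
  by_cases h : t ∈ A <;> simp [h]

theorem abs_measureReal_le_one {E : Type*} [MeasurableSpace E] (ν : Measure E)
    [IsProbabilityMeasure ν] (A : Set E) : |ν.real A| ≤ 1 := by
  rw [abs_of_nonneg measureReal_nonneg]
  exact measureReal_le_one

/-- Serves twice: for the latent variables in the sequential scheme, and for the observations in the
original one. -/
theorem tendsto_integral_prod_of_predictive {E : Type*} [MeasurableSpace E]
    {𝓗 : Filtration ℕ mΩ} {Y : ℕ → Ω → E} (hY : ∀ n, Measurable[𝓗 (n + 1)] (Y n))
    {κ : ℕ → Ω → ProbabilityMeasure E} (hκ : ∀ n, Measurable[𝓗 n] (κ n))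
    (hlaw : ∀ n A, MeasurableSet A →
      P⟦Y n ⁻¹' A | 𝓗 n⟧ =ᵐ[P] fun ω => (κ n ω : Measure E).real A)
    {G : Ω → ProbabilityMeasure E}
    (hG : ∀ A, MeasurableSet A → ∀ᵐ ω ∂P,
      Tendsto (fun n => (κ n ω : Measure E).real A) atTop (𝓝 ((G ω : Measure E).real A)))
    (k : ℕ) {A : ℕ → Set E} (hA : ∀ i, MeasurableSet (A i)) :
    Tendsto (fun n => ∫ ω, ∏ i ∈ Finset.range k, (A i).indicator (fun _ => (1 : ℝ)) (Y (n + i) ω) ∂P)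
      atTop (𝓝 (∫ ω, ∏ i ∈ Finset.range k, (G ω : Measure E).real (A i) ∂P)) := by
  have := tendsto_integral_prod_of_condExp (P := P) (𝓗 := 𝓗)
    (U := fun i n ω => (A i).indicator (fun _ => (1 : ℝ)) (Y n ω))
    (V := fun i n ω => (κ n ω : Measure E).real (A i))
    (V' := fun i ω => (G ω : Measure E).real (A i))
    (fun i n => ((measurable_const.indicator (hA i)).comp (hY n)).stronglyMeasurable)
    (fun i n ω => abs_indicator_one_le_one _ _)
    (fun i n => (@measurable_coe_apply _ _ _ (𝓗 n) _ (hκ n) _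
      (hA i)).ennreal_toReal.stronglyMeasurable)
    (fun i n ω => abs_measureReal_le_one _ _) (fun i n => hlaw n (A i) (hA i))
    (fun i => hG (A i) (hA i)) k (W := fun _ _ => 1) (W' := fun _ => 1)
    (fun n => stronglyMeasurable_const) (fun n ω => by simp) (by simp)
  simpa using this

theorem IsSequentialNewtonModel.tendsto_integral_prod
    (h : IsSequentialNewtonModel P X θ μ f α hα G₀) (hf : IsDensityFamily μ f)
    {G : Ω → ProbabilityMeasure Θ}
    (hG : ∀ A, MeasurableSet A → ∀ᵐ ω ∂P, Tendsto
      (fun n => (newtonRule α hα f G₀ n fun i => X i ω : Measure Θ).real A) atTop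
      (𝓝 ((G ω : Measure Θ).real A)))
    (k : ℕ) {A : ℕ → Set Θ} (hA : ∀ i, MeasurableSet (A i)) :
    Tendsto (fun n => ∫ ω, ∏ i ∈ Finset.range k, (A i).indicator (fun _ => (1 : ℝ)) (θ (n + i) ω) ∂P)
      atTop (𝓝 (∫ ω, ∏ i ∈ Finset.range k, (G ω : Measure Θ).real (A i) ∂P)) :=
  tendsto_integral_prod_of_predictive
    (fun n => (measurable_pastField θ n.lt_succ_self).mono le_sup_right le_rfl)
    ((h.isMixturePredictive hf).measurable_newtonRule hf) h.latent_law hG k hA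

end Models

/-! ### Replacing one coordinate by density of the mixture functions -/

section Replacement

/-- The bound involves `T` only through its law. For variables with a common law it is therefore
uniform in the index. -/
theorem abs_integral_comp_mul_sub_le {Ω Θ : Type*} [MeasurableSpace Ω] [MeasurableSpace Θ]
    {Q : Measure Ω} [IsFiniteMeasure Q] {ν : Measure Θ} {T : Ω → Θ} (hT : Measurable T)
    (hlaw : Q.map T = ν) {R : Ω → ℝ} (hR : Measurable R) {C : ℝ} (hRC : ∀ ω, |R ω| ≤ C)
    {g s : Θ → ℝ} (hg : Measurable g) (hgb : ∃ D, ∀ t, |g t| ≤ D) (hs : Measurable s)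
    (hsb : ∃ D, ∀ t, |s t| ≤ D) :
    |∫ ω, g (T ω) * R ω ∂Q - ∫ ω, s (T ω) * R ω ∂Q| ≤ C * ∫ t, |g t - s t| ∂ν := by
  have hint : ∀ {u : Θ → ℝ}, Measurable u → (∃ D, ∀ t, |u t| ≤ D) →
      Integrable (fun ω => u (T ω)) Q := fun hu ⟨D, hD⟩ =>
    Integrable.of_bound (hu.comp hT).aestronglyMeasurable D (Eventually.of_forall fun ω => hD _)
  have hintR : ∀ {u : Θ → ℝ}, Measurable u → (∃ D, ∀ t, |u t| ≤ D) →
      Integrable (fun ω => u (T ω) * R ω) Q := fun hu hD =>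
    (hint hu hD).mul_bdd hR.aestronglyMeasurable (Eventually.of_forall hRC)
  have hmap : ∫ t, |g t - s t| ∂ν = ∫ ω, |g (T ω) - s (T ω)| ∂Q := by
    have hm : Measurable fun t => |g t - s t| := (hg.sub hs).abs
    rw [← hlaw, integral_map hT.aemeasurable hm.aestronglyMeasurable]
  have hd : Integrable (fun ω => C * |g (T ω) - s (T ω)|) Q :=
    ((hint hg hgb).sub (hint hs hsb)).abs.const_mul C
  rw [← integral_sub (hintR hg hgb) (hintR hs hsb), hmap, ← integral_const_mul]
  change ‖(_ : ℝ)‖ ≤ _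
  refine norm_integral_le_of_norm_le hd (Eventually.of_forall fun ω => ?_)
  rw [← sub_mul, norm_mul, mul_comm, Real.norm_eq_abs, Real.norm_eq_abs]
  exact mul_le_mul_of_nonneg_right (hRC ω) (abs_nonneg _)

variable {Ω Θ 𝕏 : Type*} [MeasurableSpace Ω] [MeasurableSpace Θ] [MeasurableSpace 𝕏]
  {P : Measure Ω} [IsProbabilityMeasure P] {μ : Measure 𝕏} [SigmaFinite μ] {f : Θ → 𝕏 → ℝ≥0∞}
  {G₀ : ProbabilityMeasure Θ}

/-- A random probability measure, as a Markov kernel. -/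
def toKernel (G : Ω → ProbabilityMeasure Θ) (hG : Measurable G) : Kernel Ω Θ :=
  ⟨fun ω => (G ω : Measure Θ), measurable_subtype_coe.comp hG⟩

instance (G : Ω → ProbabilityMeasure Θ) (hG : Measurable G) : IsMarkovKernel (toKernel G hG) :=
  ⟨fun ω => inferInstanceAs (IsProbabilityMeasure (G ω : Measure Θ))⟩

theorem integral_toKernel_mul {G : Ω → ProbabilityMeasure Θ} (hG : Measurable G)
    {R : Ω → ℝ} (hR : Measurable R) {C : ℝ} (hRC : ∀ ω, |R ω| ≤ C)
    {g : Θ → ℝ} (hg : Measurable g) (hgb : ∃ D, ∀ t, |g t| ≤ D) :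
    ∫ p, g p.2 * R p.1 ∂(P ⊗ₘ toKernel G hG)
      = ∫ ω, (∫ t, g t ∂(G ω : Measure Θ)) * R ω ∂P := by
  obtain ⟨D, hD⟩ := hgb
  rw [Measure.integral_compProd]
  · simp_rw [integral_mul_const]
    rfl
  · refine Integrable.mul_bdd (c := C) (Integrable.of_bound (C := D)
      (hg.comp measurable_snd).aestronglyMeasurable (Eventually.of_forall fun p => hD _))
      (hR.comp measurable_fst).aestronglyMeasurable (Eventually.of_forall fun p => hRC _)

theorem map_snd_compProd_toKernel {G : Ω → ProbabilityMeasure Θ} (hG : Measurable G)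
    (hmean : ∀ A, MeasurableSet A → ∫⁻ ω, (G ω : Measure Θ) A ∂P = (G₀ : Measure Θ) A) :
    (P ⊗ₘ toKernel G hG).map Prod.snd = G₀ := by
  ext A hA
  rw [← hmean A hA, Measure.map_apply measurable_snd hA,
    Measure.compProd_apply (measurable_snd hA)]
  rfl

/-- If a coordinate of a mean of products has a fixed law, then convergence for the functions
`t ↦ F_t(B)` of this coordinate implies convergence for all its bounded measurable functions. -/
theorem Identifiable.tendsto_integral_comp_mul (hident : Identifiable μ f)
    (hf : IsDensityFamily μ f) {T : ℕ → Ω → Θ} (hT : ∀ n, Measurable (T n))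
    (hlaw : ∀ n, P.map (T n) = G₀) {G : Ω → ProbabilityMeasure Θ} (hG : Measurable G)
    (hmean : ∀ A, MeasurableSet A → ∫⁻ ω, (G ω : Measure Θ) A ∂P = (G₀ : Measure Θ) A)
    {R : ℕ → Ω → ℝ} {R' : Ω → ℝ} (hR : ∀ n, Measurable (R n)) (hR' : Measurable R') {C : ℝ}
    (hRC : ∀ n ω, |R n ω| ≤ C) (hR'C : ∀ ω, |R' ω| ≤ C)
    (hlim : ∀ B, MeasurableSet B →
      Tendsto (fun n => ∫ ω, (μ.withDensity (f (T n ω))).real B * R n ω ∂P) atTop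
        (𝓝 (∫ ω, (∫ t, (μ.withDensity (f t)).real B ∂(G ω : Measure Θ)) * R' ω ∂P)))
    {g : Θ → ℝ} (hg : Measurable g) (hgb : ∃ D, ∀ t, |g t| ≤ D) :
    Tendsto (fun n => ∫ ω, g (T n ω) * R n ω ∂P) atTop
      (𝓝 (∫ ω, (∫ t, g t ∂(G ω : Measure Θ)) * R' ω ∂P)) := by
  have hintR : ∀ {u : Θ → ℝ}, Measurable u → (∃ D, ∀ t, |u t| ≤ D) → ∀ n,
      Integrable (fun ω => u (T n ω) * R n ω) P := fun hu ⟨D, hD⟩ n =>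
    Integrable.mul_bdd (c := C) (Integrable.of_bound (C := D)
      (hu.comp (hT n)).aestronglyMeasurable (Eventually.of_forall fun ω => hD _))
      (hR n).aestronglyMeasurable (Eventually.of_forall (hRC n))
  have hintK : ∀ {u : Θ → ℝ}, Measurable u → (∃ D, ∀ t, |u t| ≤ D) →
      Integrable (fun p : Ω × Θ => u p.2 * R' p.1) (P ⊗ₘ toKernel G hG) := fun hu ⟨D, hD⟩ =>
    Integrable.mul_bdd (c := C) (Integrable.of_bound (C := D)
      (hu.comp measurable_snd).aestronglyMeasurable (Eventually.of_forall fun p => hD _))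
      (hR'.comp measurable_fst).aestronglyMeasurable (Eventually.of_forall fun p => hR'C _)
  -- The functions for which the convergence holds. The limit is written as an integral over `P ⊗ₘ
  -- toKernel G hG`, whose second marginal is `G₀`, so the same approximation bound applies to it as
  -- to each term.
  let S : Submodule ℝ (Θ → ℝ) :=
    { carrier := {s | (Measurable s ∧ ∃ D, ∀ t, |s t| ≤ D) ∧
        Tendsto (fun n => ∫ ω, s (T n ω) * R n ω ∂P) atTop
          (𝓝 (∫ p, s p.2 * R' p.1 ∂(P ⊗ₘ toKernel G hG)))}
      zero_mem' := by
        refine ⟨⟨measurable_const, 0, by simp⟩, ?_⟩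
        simp
      add_mem' := by
        rintro s s' ⟨⟨hs, D, hD⟩, hlim⟩ ⟨⟨hs', D', hD'⟩, hlim'⟩
        refine ⟨⟨hs.add hs', D + D', fun t => (abs_add_le _ _).trans (add_le_add (hD t) (hD' t))⟩, ?_⟩
        simp only [Pi.add_apply, add_mul]
        rw [integral_add (hintK hs ⟨D, hD⟩) (hintK hs' ⟨D', hD'⟩)]
        simp_rw [integral_add (hintR hs ⟨D, hD⟩ _) (hintR hs' ⟨D', hD'⟩ _)]
        exact hlim.add hlim'
      smul_mem' := by
        rintro c s ⟨⟨hs, D, hD⟩, hlim⟩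
        refine ⟨⟨hs.const_smul c, |c| * D, fun t => ?_⟩, ?_⟩
        · rw [Pi.smul_apply, smul_eq_mul, abs_mul]
          exact mul_le_mul_of_nonneg_left (hD t) (abs_nonneg c)
        · simp only [Pi.smul_apply, smul_eq_mul, mul_assoc, integral_const_mul]
          exact hlim.const_mul c }
  have hC : 0 ≤ C := by
    obtain ⟨ω⟩ := nonempty_of_isProbabilityMeasure P
    exact (abs_nonneg _).trans (hR'C ω)
  have hmemS : g ∈ S := by
    refine hident.mem_submodule hf (G₀ : Measure Θ) S (fun s hs => hs.1) (fun B hB => ?_)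
      (fun g hg hgb happ => ⟨⟨hg, hgb⟩, ?_⟩) hg hgb
    · have hp : Measurable fun t => (μ.withDensity (f t)).real B :=
        (measurable_withDensity_apply hf.measurable hB).ennreal_toReal
      have hpb : ∃ D, ∀ t, |(μ.withDensity (f t)).real B| ≤ D := ⟨1, fun t =>
        have := hf.isProbabilityMeasure_withDensity t
        abs_measureReal_le_one _ _⟩
      refine ⟨⟨hp, hpb⟩, ?_⟩
      have := hlim B hB
      rwa [← integral_toKernel_mul hG hR' hR'C hp hpb] at this
    · rw [Metric.tendsto_atTop]
      intro ε hε
      -- The usual three thirds of `ε`; `C + 1` avoids dividing by zero when `C = 0`.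
      obtain ⟨s, ⟨⟨hs, hsb⟩, hslim⟩, happ⟩ := happ (ε / (3 * (C + 1))) (by positivity)
      have hsmall : C * ∫ t, |g t - s t| ∂(G₀ : Measure Θ) ≤ ε / 3 := by
        calc _ ≤ (C + 1) * (ε / (3 * (C + 1))) :=
              mul_le_mul (by linarith) happ (integral_nonneg fun t => abs_nonneg _) (by linarith)
          _ = ε / 3 := by field_simp
      obtain ⟨N, hN⟩ := Metric.tendsto_atTop.1 hslim (ε / 3) (by positivity)
      refine ⟨N, fun n hn => ?_⟩
      have h1 := abs_integral_comp_mul_sub_le (hT n) (hlaw n) (hR n) (hRC n) hg hgb hs hsb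
      have h2 := abs_integral_comp_mul_sub_le (Q := P ⊗ₘ toKernel G hG) measurable_snd
        (map_snd_compProd_toKernel hG hmean) (hR'.comp measurable_fst) (fun p => hR'C p.1)
        hg hgb hs hsb
      have h3 := hN n hn
      rw [Real.dist_eq] at h3 ⊢
      simp only [Function.comp_apply] at h2
      rw [abs_le] at h1 h2
      rw [abs_lt] at h3 ⊢
      constructor <;> linarith [h1.1, h1.2, h2.1, h2.2, h3.1, h3.2]
  rw [← integral_toKernel_mul hG hR' hR'C hg hgb]
  exact hmemS.2

end Replacement

theorem prod_range_update {β M : Type*} [CommMonoid M] {k j : ℕ} (hj : j < k) (g : ℕ → β) (u : β)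
    (F : ℕ → β → M) : ∏ i ∈ Finset.range k, F i (Function.update g j u i)
      = F j u * ∏ i ∈ (Finset.range k).erase j, F i (g i) := by
  rw [← Finset.mul_prod_erase _ _ (Finset.mem_range.2 hj), Function.update_self]
  congr 1
  refine Finset.prod_congr rfl fun i hi => ?_
  rw [Function.update_of_ne (Finset.ne_of_mem_erase hi)]

theorem abs_prod_le_one {ι : Type*} (s : Finset ι) {a : ι → ℝ} (ha : ∀ i, |a i| ≤ 1) :
    |∏ i ∈ s, a i| ≤ 1 := by
  simpa using abs_prod_mul_le_one s ha (b := 1) (by simp)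

/-! ### Masses of the mixture components as bounded functions -/

section Mixture

variable {Θ 𝕏 : Type*} [MeasurableSpace Θ] [MeasurableSpace 𝕏] {μ : Measure 𝕏}
  {f : Θ → 𝕏 → ℝ≥0∞}

theorem IsDensityFamily.abs_withDensity_real_le_one (hf : IsDensityFamily μ f) (B : Set 𝕏)
    (t : Θ) : |(μ.withDensity (f t)).real B| ≤ 1 :=
  have := hf.isProbabilityMeasure_withDensity t
  abs_measureReal_le_one _ _

variable [SigmaFinite μ]

theorem IsDensityFamily.measurable_withDensity_real (hf : IsDensityFamily μ f) {B : Set 𝕏}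
    (hB : MeasurableSet B) : Measurable fun t => (μ.withDensity (f t)).real B :=
  (measurable_withDensity_apply hf.measurable hB).ennreal_toReal

theorem IsDensityFamily.mixture_real (hf : IsDensityFamily μ f) (G : Measure Θ) [SFinite G]
    {B : Set 𝕏} (hB : MeasurableSet B) :
    (mixture μ f G).real B = ∫ t, (μ.withDensity (f t)).real B ∂G := by
  rw [measureReal_def, mixture_apply hf.measurable _ hB]
  exact (integral_toReal (measurable_withDensity_apply hf.measurable hB).aemeasurable
    (Eventually.of_forall fun t => (hf.withDensity_le_one t B).trans_lt ENNReal.one_lt_top)).symm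

end Mixture

/-! ### Latent variables in the original scheme -/

section IsNewtonModel

variable {Ω Θ 𝕏 : Type*} [mΩ : MeasurableSpace Ω] [MeasurableSpace Θ] [MeasurableSpace 𝕏]
  {P : Measure Ω} [IsProbabilityMeasure P] {X : ℕ → Ω → 𝕏} {θ : ℕ → Ω → Θ} {μ : Measure 𝕏}
  [SigmaFinite μ] {f : Θ → 𝕏 → ℝ≥0∞} {α : ℕ → ℝ} {hα : ∀ n, α n ∈ Set.Ioo (0 : ℝ) 1}
  {G₀ : ProbabilityMeasure Θ}

namespace IsNewtonModel

/-- Given the latent variables, the observations are independent. -/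
theorem integral_prod_obs_mul (h : IsNewtonModel P X θ μ f α hα G₀) (hf : IsDensityFamily μ f)
    {B : ℕ → Set 𝕏} (hB : ∀ i, MeasurableSet (B i)) (n k : ℕ) {Z : Ω → ℝ}
    (hZ : StronglyMeasurable[fullField θ] Z) (hZ1 : ∀ ω, |Z ω| ≤ 1) :
    ∫ ω, (∏ i ∈ Finset.range k, (B i).indicator (fun _ => (1 : ℝ)) (X (n + i) ω)) * Z ω ∂P
      = ∫ ω, (∏ i ∈ Finset.range k, (μ.withDensity (f (θ (n + i) ω))).real (B i)) * Z ω ∂P := by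
  induction k generalizing Z with
  | zero => simp
  | succ k ih =>
    have hp : StronglyMeasurable[fullField θ]
        fun ω => (μ.withDensity (f (θ (n + k) ω))).real (B k) :=
      ((hf.measurable_withDensity_real (hB k)).comp
        (measurable_fullField θ (n + k))).stronglyMeasurable
    have hind : StronglyMeasurable[pastField X (n + k) ⊔ fullField θ] fun ω =>
        (∏ i ∈ Finset.range k, (B i).indicator (fun _ => (1 : ℝ)) (X (n + i) ω)) * Z ω := by
      refine StronglyMeasurable.mul
        (Finset.stronglyMeasurable_fun_prod _ fun i hi => ?_) (hZ.mono le_sup_right)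
      have hi' := Finset.mem_range.1 hi
      exact (((measurable_const.indicator (hB i)).comp
        (measurable_pastField X (show n + i < n + k by omega))).stronglyMeasurable).mono le_sup_left
    -- The last observation is conditioned on the earlier ones and on all of `θ`. The factor
    -- obtained depends on `θ` only and joins `Z`, which is why `Z` is general in the induction.
    have key := integral_mul_eq_of_condExp
      (sup_le ((pastFiltration h.measurable_obs).le (n + k)) (fullField_le h.measurable_latent))
      hind (fun ω => abs_prod_mul_le_one _ (fun i => abs_indicator_one_le_one _ _) (hZ1 ω))
      ((integrable_const (1 : ℝ)).indicator (h.measurable_obs (n + k) (hB k)))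
      (h.obs_law (n + k) (B k) (hB k))
    have hih := ih (Z := fun ω => (μ.withDensity (f (θ (n + k) ω))).real (B k) * Z ω) (hp.mul hZ)
      fun ω => by
        rw [abs_mul]
        exact mul_le_one₀ (hf.abs_withDensity_real_le_one _ _) (abs_nonneg _) (hZ1 ω)
    simp_rw [Finset.prod_range_succ]
    calc _ = ∫ ω, ((∏ i ∈ Finset.range k, (B i).indicator (fun _ => (1 : ℝ)) (X (n + i) ω)) * Z ω)
            * (X (n + k) ⁻¹' B k).indicator (fun _ => (1 : ℝ)) ω ∂P :=
          integral_congr_ae (Eventually.of_forall fun ω => mul_right_comm _ _ _)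
      _ = _ := key
      _ = _ := by simp_rw [mul_assoc, mul_comm (Z _)]; exact hih
      _ = _ := by simp_rw [mul_assoc]

/-- The law of `θ n` is the mean of `G_n`, which stays equal to `G₀` by the martingale property. -/
theorem map_latent (h : IsNewtonModel P X θ μ f α hα G₀) (hf : IsDensityFamily μ f) (n : ℕ) :
    P.map (θ n) = G₀ := by
  ext A hA
  have hm := h.isMixturePredictive hf
  have hH : Measurable[(pastField X n).prod inferInstance]
      fun p : Ω × Θ => A.indicator (fun _ => (1 : ℝ≥0∞)) p.2 :=
    (measurable_const.indicator hA).comp (@measurable_snd _ _ (pastField X n) _)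
  have key := lintegral_prodMk_of_condExp ((pastFiltration h.measurable_obs).le n)
    (h.measurable_latent n) (hm.measurable_newtonRule hf n) (h.latent_law n) hH
  simp only [lintegral_indicator_const hA, one_mul] at key
  rw [(hm.convergesSetwise hf).mean n A hA] at key
  rw [← key, Measure.map_apply (h.measurable_latent n) hA]
  exact (lintegral_indicator_one (h.measurable_latent n hA)).symm

variable [StandardBorelSpace Θ]

/-- The predictive laws of the observations converge setwise to the mixture under `G`, which settles
products of indicators of observations. Conditional independence given `θ` then turns each indicator
into the mass of its component. -/
theorem tendsto_integral_prod_density (h : IsNewtonModel P X θ μ f α hα G₀)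
    (hf : IsDensityFamily μ f) {G : Ω → ProbabilityMeasure Θ}
    (hG : ∀ A, MeasurableSet A → ∀ᵐ ω ∂P, Tendsto
      (fun n => (newtonRule α hα f G₀ n fun i => X i ω : Measure Θ) A) atTop
      (𝓝 ((G ω : Measure Θ) A)))
    (k : ℕ) {B : ℕ → Set 𝕏} (hB : ∀ i, MeasurableSet (B i)) :
    Tendsto (fun n => ∫ ω, ∏ i ∈ Finset.range k,
        (μ.withDensity (f (θ (n + i) ω))).real (B i) ∂P) atTop
      (𝓝 (∫ ω, ∏ i ∈ Finset.range k,
        (∫ t, (μ.withDensity (f t)).real (B i) ∂(G ω : Measure Θ)) ∂P)) := by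
  have hm := h.isMixturePredictive hf
  have hlim := tendsto_integral_prod_of_predictive (P := P) hm.adapted
    (κ := fun n ω => mixtureLaw hf (newtonRule α hα f G₀ n fun i => X i ω))
    (fun n => (measurable_mixtureLaw hf).comp (hm.measurable_newtonRule hf n)) hm.obs_law
    (G := fun ω => mixtureLaw hf (G ω)) (fun A hA => by
      have := ae_tendsto_integral_of_measurable hG (hf.measurable_withDensity_real hA)
        (hf.abs_withDensity_real_le_one A)
      filter_upwards [this] with ω hω
      simpa only [mixtureLaw, ProbabilityMeasure.coe_mk, hf.mixture_real _ hA] using hω) k hB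
  simp only [mixtureLaw, ProbabilityMeasure.coe_mk, hf.mixture_real _ (hB _)] at hlim
  refine hlim.congr fun n => ?_
  simpa using h.integral_prod_obs_mul hf hB n k (Z := fun _ => 1) stronglyMeasurable_const (by simp)

/-- The first `j` coordinates carry arbitrary bounded functions and the others functions `t ↦
F_t(B)`. Each step of the induction frees one more coordinate: with the rest fixed, convergence for
every `F_t(B)` there gives convergence for every bounded measurable function. -/
theorem tendsto_integral_prod_aux (h : IsNewtonModel P X θ μ f α hα G₀)
    (hf : IsDensityFamily μ f) (hident : Identifiable μ f) {G : Ω → ProbabilityMeasure Θ}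
    (hGm : Measurable G)
    (hmean : ∀ A, MeasurableSet A → ∫⁻ ω, (G ω : Measure Θ) A ∂P = (G₀ : Measure Θ) A)
    (hG : ∀ A, MeasurableSet A → ∀ᵐ ω ∂P, Tendsto
      (fun n => (newtonRule α hα f G₀ n fun i => X i ω : Measure Θ) A) atTop
      (𝓝 ((G ω : Measure Θ) A)))
    (k j : ℕ) {g : ℕ → Θ → ℝ} (hg : ∀ i, Measurable (g i)) (hg1 : ∀ i t, |g i t| ≤ 1)
    (hgj : ∀ i, j ≤ i → ∃ B, MeasurableSet B ∧ g i = fun t => (μ.withDensity (f t)).real B) :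
    Tendsto (fun n => ∫ ω, ∏ i ∈ Finset.range k, g i (θ (n + i) ω) ∂P) atTop
      (𝓝 (∫ ω, ∏ i ∈ Finset.range k, (∫ t, g i t ∂(G ω : Measure Θ)) ∂P)) := by
  induction j generalizing g with
  | zero =>
    choose B hB hgB using fun i => hgj i (Nat.zero_le i)
    obtain rfl : g = fun i t => (μ.withDensity (f t)).real (B i) := funext hgB
    exact h.tendsto_integral_prod_density hf hG k hB
  | succ j ih =>
    have hupd : ∀ B, MeasurableSet B →
        Tendsto (fun n => ∫ ω, ∏ i ∈ Finset.range k, (Function.update g j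
            fun t => (μ.withDensity (f t)).real B) i (θ (n + i) ω) ∂P) atTop
          (𝓝 (∫ ω, ∏ i ∈ Finset.range k, (∫ t, (Function.update g j
            fun t => (μ.withDensity (f t)).real B) i t ∂(G ω : Measure Θ)) ∂P)) := fun B hB => by
      refine ih (fun i => ?_) (fun i t => ?_) fun i hi => ?_
      all_goals rcases eq_or_ne i j with rfl | hij
      · simpa using hf.measurable_withDensity_real hB
      · simpa [hij] using hg i
      · simpa using hf.abs_withDensity_real_le_one B t
      · simpa [hij] using hg1 i t
      · exact ⟨B, hB, Function.update_self _ _ _⟩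
      · rw [Function.update_of_ne hij]
        exact hgj i (by omega)
    by_cases hj : j < k
    · simp_rw [← Finset.mul_prod_erase _ _ (Finset.mem_range.2 hj)]
      have hint : ∀ i, Measurable fun ω => ∫ t, g i t ∂(G ω : Measure Θ) := fun i =>
        ((hg i).stronglyMeasurable.integral_kernel (κ := toKernel G hGm)).measurable
      have hint1 : ∀ i ω, |∫ t, g i t ∂(G ω : Measure Θ)| ≤ 1 := fun i ω => by
        have := norm_integral_le_of_norm_le_const (μ := (G ω : Measure Θ))
          (f := g i) (C := 1) (Eventually.of_forall (hg1 i))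
        simpa using this
      refine hident.tendsto_integral_comp_mul hf (T := fun n => θ (n + j))
        (fun n => h.measurable_latent _) (fun n => h.map_latent hf _) hGm hmean
        (fun n => Finset.measurable_fun_prod _ fun i _ => (hg i).comp (h.measurable_latent _))
        (Finset.measurable_fun_prod _ fun i _ => hint i)
        (fun n ω => abs_prod_le_one _ fun i => hg1 i _)
        (fun ω => abs_prod_le_one _ fun i => hint1 i ω) (fun B hB => ?_) (hg j) ⟨1, hg1 j⟩
      have := hupd B hB
      refine Tendsto.congr (fun n => integral_congr_ae (Eventually.of_forall fun ω =>
        prod_range_update hj g _ fun i (u : Θ → ℝ) => u (θ (n + i) ω)))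
        (this.trans (le_of_eq (congrArg 𝓝 (integral_congr_ae (Eventually.of_forall fun ω =>
          prod_range_update hj g _ fun i (u : Θ → ℝ) => ∫ t, u t ∂(G ω : Measure Θ))))))
    -- Coordinate `j` does not occur in the product, so it can be overwritten by the mass of
    -- `Set.univ` to meet the induction hypothesis.
    · have hne : ∀ i ∈ Finset.range k, i ≠ j := fun i hi => by
        have := Finset.mem_range.1 hi; omega
      have hcongr : ∀ F : ℕ → (Θ → ℝ) → ℝ, ∏ i ∈ Finset.range k, F i (Function.update g j
          (fun t => (μ.withDensity (f t)).real Set.univ) i) = ∏ i ∈ Finset.range k, F i (g i) :=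
        fun F => Finset.prod_congr rfl fun i hi => by rw [Function.update_of_ne (hne i hi)]
      have := hupd Set.univ MeasurableSet.univ
      exact Tendsto.congr (fun n => integral_congr_ae (Eventually.of_forall fun ω =>
        hcongr fun i u => u (θ (n + i) ω)))
        (this.trans (le_of_eq (congrArg 𝓝 (integral_congr_ae (Eventually.of_forall fun ω =>
          hcongr fun i u => ∫ t, u t ∂(G ω : Measure Θ))))))

theorem tendsto_integral_prod (h : IsNewtonModel P X θ μ f α hα G₀)
    (hf : IsDensityFamily μ f) (hident : Identifiable μ f) {G : Ω → ProbabilityMeasure Θ}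
    (hGm : Measurable G)
    (hmean : ∀ A, MeasurableSet A → ∫⁻ ω, (G ω : Measure Θ) A ∂P = (G₀ : Measure Θ) A)
    (hG : ∀ A, MeasurableSet A → ∀ᵐ ω ∂P, Tendsto
      (fun n => (newtonRule α hα f G₀ n fun i => X i ω : Measure Θ) A) atTop
      (𝓝 ((G ω : Measure Θ) A)))
    (k : ℕ) {A : ℕ → Set Θ} (hA : ∀ i, MeasurableSet (A i)) :
    Tendsto (fun n => ∫ ω, ∏ i ∈ Finset.range k, (A i).indicator (fun _ => (1 : ℝ)) (θ (n + i) ω) ∂P)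
      atTop (𝓝 (∫ ω, ∏ i ∈ Finset.range k, (G ω : Measure Θ).real (A i) ∂P)) := by
  classical
  -- With `j = k` all coordinates in the product are free; those beyond `k` are filled with a
  -- function of the required form.
  have := h.tendsto_integral_prod_aux hf hident hGm hmean hG k k
    (g := fun i => if i < k then (A i).indicator fun _ => 1 else
      fun t => (μ.withDensity (f t)).real Set.univ) (fun i => ?_) (fun i t => ?_)
    fun i hi => ⟨Set.univ, MeasurableSet.univ, if_neg (by omega)⟩
  · refine Tendsto.congr (fun n => integral_congr_ae (Eventually.of_forall fun ω =>
      Finset.prod_congr rfl fun i hi => ?_)) (this.trans (le_of_eq (congrArg 𝓝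
      (integral_congr_ae (Eventually.of_forall fun ω => Finset.prod_congr rfl fun i hi => ?_)))))
    · simp only [if_pos (Finset.mem_range.1 hi)]
    · simp only [if_pos (Finset.mem_range.1 hi)]
      exact integral_indicator_one (hA i)
  · split_ifs
    exacts [measurable_const.indicator (hA i), hf.measurable_withDensity_real MeasurableSet.univ]
  · split_ifs
    exacts [abs_indicator_one_le_one _ _, hf.abs_withDensity_real_le_one _ _]

end IsNewtonModel

end IsNewtonModel

theorem prod_indicator_eq_indicator_pi {E : Type*} (k : ℕ) (A : ℕ → Set E) (z : ℕ → E) :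
    ∏ i ∈ Finset.range k, (A i).indicator (fun _ => (1 : ℝ)) (z i)
      = (Set.pi (Finset.range k : Set ℕ) A).indicator (fun _ => 1) z := by
  classical
  by_cases h : z ∈ Set.pi (Finset.range k : Set ℕ) A
  · rw [Set.indicator_of_mem h]
    exact Finset.prod_eq_one fun i hi => Set.indicator_of_mem (h i hi) _
  · rw [Set.indicator_of_notMem h]
    obtain ⟨i, hi, hiA⟩ : ∃ i ∈ Finset.range k, z i ∉ A i := by
      simpa [Set.mem_pi] using h
    exact Finset.prod_eq_zero hi (Set.indicator_of_notMem hiA _)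

/-! ### Boxes in the sequence space -/

section Cylinders

/-- The measurable sets of sequences that restrict finitely many coordinates, each separately. -/
def boxes (E : Type*) [MeasurableSpace E] : Set (Set (ℕ → E)) :=
  {s | ∃ (k : ℕ) (A : ℕ → Set E), (∀ i, MeasurableSet (A i)) ∧
    s = Set.pi (Finset.range k : Set ℕ) A}

variable {E : Type*} [MeasurableSpace E]

theorem measurableSet_of_mem_boxes {s : Set (ℕ → E)} (hs : s ∈ boxes E) : MeasurableSet s := by
  obtain ⟨k, A, hA, rfl⟩ := hs
  exact MeasurableSet.pi (Finset.countable_toSet _) fun i _ => hA i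

theorem isPiSystem_boxes : IsPiSystem (boxes E) := by
  classical
  rintro _ ⟨k, A, hA, rfl⟩ _ ⟨k', A', hA', rfl⟩ -
  refine ⟨max k k', fun i => (if i < k then A i else Set.univ) ∩ if i < k' then A' i else Set.univ,
    fun i => ?_, ?_⟩
  · refine MeasurableSet.inter ?_ ?_ <;> split_ifs
    exacts [hA i, MeasurableSet.univ, hA' i, MeasurableSet.univ]
  · ext z
    simp only [Set.mem_inter_iff, Set.mem_pi, Finset.coe_range, Set.mem_Iio, lt_sup_iff]
    refine ⟨fun ⟨h, h'⟩ i _ => ⟨?_, ?_⟩, fun h => ⟨fun i hi => ?_, fun i hi => ?_⟩⟩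
    · split_ifs with hi
      exacts [h i hi, trivial]
    · split_ifs with hi
      exacts [h' i hi, trivial]
    · simpa [hi] using (h i (Or.inl hi)).1
    · simpa [hi] using (h i (Or.inr hi)).2

theorem generateFrom_boxes :
    (MeasurableSpace.pi : MeasurableSpace (ℕ → E)) = MeasurableSpace.generateFrom (boxes E) := by
  classical
  refine le_antisymm (iSup_le fun i => ?_)
    (MeasurableSpace.generateFrom_le fun s hs => measurableSet_of_mem_boxes hs)
  rintro _ ⟨A, hA, rfl⟩
  refine MeasurableSpace.measurableSet_generateFrom
    ⟨i + 1, fun j => if j = i then A else Set.univ, fun j => ?_, ?_⟩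
  · change MeasurableSet (if j = i then A else Set.univ)
    split_ifs
    exacts [hA, MeasurableSet.univ]
  · ext z
    simp only [Set.mem_preimage, Set.mem_pi, Finset.coe_range, Set.mem_Iio]
    refine ⟨fun h j _ => ?_, fun h => by simpa using h i i.lt_succ_self⟩
    split_ifs with hj
    exacts [hj ▸ h, trivial]

theorem exists_mem_boxes_nhds [TopologicalSpace E] [OpensMeasurableSpace E] {u : Set (ℕ → E)}
    (hu : IsOpen u) {z : ℕ → E} (hz : z ∈ u) : ∃ s ∈ boxes E, s ∈ 𝓝 z ∧ s ⊆ u := by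
  classical
  obtain ⟨I, V, hV, hVu⟩ := isOpen_pi_iff.1 hu z hz
  have hopen : ∀ i, IsOpen (if i ∈ I then V i else Set.univ) := fun i => by
    split_ifs with hi
    exacts [(hV i hi).1, isOpen_univ]
  -- The box has to reach past the largest restricted coordinate; the unrestricted ones receive the
  -- whole space.
  refine ⟨_, ⟨I.sup id + 1, fun i => if i ∈ I then V i else Set.univ,
    fun i => (hopen i).measurableSet, rfl⟩, ?_, ?_⟩
  · refine (isOpen_set_pi (Finset.finite_toSet _) fun i _ => hopen i).mem_nhds fun i _ => ?_
    simp only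
    split_ifs with hi
    exacts [(hV i hi).2, trivial]
  · refine fun y hy => hVu fun i hi => ?_
    have hi' : i ∈ I := hi
    have := hy i (by
      simpa [Nat.lt_succ_iff] using Finset.le_sup (f := id) hi')
    simpa [hi'] using this

end Cylinders

/-! ### Mixtures of i.i.d. sequences and the extended space -/

section Extension

variable {Ω E : Type*} [MeasurableSpace Ω] [MeasurableSpace E]

/-- The law of an i.i.d. sequence whose marginal law is random. -/
noncomputable def iidKernel (G : Ω → ProbabilityMeasure E) (hG : Measurable G) :
    Kernel Ω (ℕ → E) :=
  ⟨fun ω => Measure.infinitePi fun _ => (G ω : Measure E), by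
    refine Measurable.measure_of_isPiSystem_of_isProbabilityMeasure generateFrom_boxes
      isPiSystem_boxes ?_
    rintro _ ⟨k, A, hA, rfl⟩
    simp_rw [Measure.infinitePi_pi _ fun i _ => hA i]
    exact Finset.measurable_fun_prod _ fun i _ => measurable_coe_apply hG (hA i)⟩

variable {G : Ω → ProbabilityMeasure E} {hG : Measurable G}

instance : IsMarkovKernel (iidKernel G hG) :=
  ⟨fun ω => inferInstanceAs (IsProbabilityMeasure (Measure.infinitePi fun _ => (G ω : Measure E)))⟩

variable {P : Measure Ω} [IsProbabilityMeasure P]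

/-- Given `ω`, any injective selection of `n` coordinates is i.i.d. with law `G ω`; the selections
by `σ` and by the identity therefore have the same law. -/
theorem exchangeable_iidKernel :
    Exchangeable (P ⊗ₘ iidKernel G hG) (fun i (p : Ω × (ℕ → E)) => p.2 i) where
  measurable n := (measurable_pi_apply n).comp measurable_snd
  map_perm n σ := by
    have hmap : ∀ τ : Fin n → ℕ, Function.Injective τ → ∀ ω,
        (iidKernel G hG ω).map (fun z i => z (τ i)) = Measure.infinitePi fun _ => (G ω : Measure E) :=
      fun τ hτ ω => Measure.map_infinitePi_infinitePi_of_inj hτ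
    ext S hS
    have hm : ∀ τ : Fin n → ℕ, Measurable fun z : ℕ → E => fun i => z (τ i) := fun τ =>
      measurable_pi_lambda _ fun i => measurable_pi_apply _
    have hval : ∀ τ : Fin n → ℕ, Function.Injective τ →
        (P ⊗ₘ iidKernel G hG).map (fun p i => p.2 (τ i)) S
          = ∫⁻ ω, Measure.infinitePi (fun _ : Fin n => (G ω : Measure E)) S ∂P := fun τ hτ => by
      have hmp : Measurable fun p : Ω × (ℕ → E) => fun i => p.2 (τ i) := (hm τ).comp measurable_snd
      rw [Measure.map_apply hmp hS, Measure.compProd_apply (hmp hS)]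
      refine lintegral_congr fun ω => ?_
      rw [← hmap τ hτ ω, Measure.map_apply (hm τ) hS]
      rfl
    exact (hval (fun i => σ i) (Fin.val_injective.comp σ.injective)).trans
      (hval (fun i => i) Fin.val_injective).symm

theorem empirical_real (z : ℕ → E) (n : ℕ) {A : Set E} (hA : MeasurableSet A) :
    (empirical z n : Measure E).real A
      = (∑ i ∈ Finset.range (n + 1), A.indicator (fun _ => (1 : ℝ)) (z i)) / (n + 1 : ℕ) := by
  simp only [empirical, ProbabilityMeasure.coe_mk, measureReal_def, Measure.smul_apply,
    Measure.coe_finsetSum, Finset.sum_apply, Measure.dirac_apply' _ hA, smul_eq_mul]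
  rw [ENNReal.toReal_mul, ENNReal.toReal_sum fun i _ => by by_cases h : z i ∈ A <;> simp [h],
    ENNReal.toReal_inv, ENNReal.toReal_natCast, div_eq_inv_mul]
  congr 1
  refine Finset.sum_congr rfl fun i _ => ?_
  by_cases h : z i ∈ A <;> simp [h]

theorem ae_tendsto_empirical_real (ν : Measure E) [IsProbabilityMeasure ν] {A : Set E}
    (hA : MeasurableSet A) :
    ∀ᵐ z ∂(Measure.infinitePi fun _ : ℕ => ν),
      Tendsto (fun n => (empirical z n : Measure E).real A) atTop (𝓝 (ν.real A)) := by
  have hu : Measurable (A.indicator fun _ => (1 : ℝ)) := measurable_const.indicator hA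
  have hind := iIndepFun_infinitePi (P := fun _ : ℕ => ν)
    (X := fun _ => A.indicator fun _ => (1 : ℝ)) fun _ => hu
  have hev : ∀ i, IdentDistrib (fun z : ℕ → E => z i) (fun z => z 0)
      (Measure.infinitePi fun _ : ℕ => ν) (Measure.infinitePi fun _ : ℕ => ν) := fun i =>
    ⟨(measurable_pi_apply i).aemeasurable, (measurable_pi_apply 0).aemeasurable,
      (Measure.infinitePi_map_eval (fun _ => ν) i).trans
        (Measure.infinitePi_map_eval (fun _ => ν) 0).symm⟩
  have hlaw := strong_law_ae_real (μ := Measure.infinitePi fun _ : ℕ => ν)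
    (fun i z => A.indicator (fun _ => (1 : ℝ)) (z i))
    (Integrable.of_bound (hu.comp (measurable_pi_apply 0)).aestronglyMeasurable 1
      (Eventually.of_forall fun z => abs_indicator_one_le_one _ _))
    (fun i j hij => hind.indepFun hij) fun i => (hev i).comp hu
  have hmean : ∫ z, A.indicator (fun _ => (1 : ℝ)) (z 0) ∂(Measure.infinitePi fun _ : ℕ => ν)
      = ν.real A := by
    rw [← integral_map (measurable_pi_apply 0).aemeasurable hu.aestronglyMeasurable,
      Measure.infinitePi_map_eval]
    exact integral_indicator_one hA
  rw [hmean] at hlaw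
  filter_upwards [hlaw] with z hz
  simp_rw [empirical_real z _ hA]
  -- `empirical z n` averages `n + 1` terms, hence the shift by one in the strong law.
  exact hz.comp (tendsto_add_atTop_nat 1)

theorem isDirectingMeasure_iidKernel [TopologicalSpace E] [SecondCountableTopology E]
    [OpensMeasurableSpace E] :
    IsDirectingMeasure (P ⊗ₘ iidKernel G hG) (fun i (p : Ω × (ℕ → E)) => p.2 i)
      (fun p => G p.1) where
  exchangeable := exchangeable_iidKernel
  measurable := hG.comp measurable_fst
  tendsto_empirical := by
    refine ae_tendsto_of_forall_measurableSet fun A hA => ?_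
    have hreal : ∀ᵐ p ∂(P ⊗ₘ iidKernel G hG), Tendsto
        (fun n => (empirical (fun i => p.2 i) n : Measure E).real A) atTop
        (𝓝 ((G p.1 : Measure E).real A)) := by
      -- The strong law holds under each `G ω` separately; measurability of the convergence set
      -- allows the fibres to be combined.
      refine Measure.ae_compProd_of_ae_ae ?_
        (Eventually.of_forall fun ω => ae_tendsto_empirical_real (G ω : Measure E) hA)
      refine measurableSet_tendsto_fun (fun n => ?_)
        (measurable_coe_apply (hG.comp measurable_fst) hA).ennreal_toReal
      simp_rw [empirical_real _ n hA]
      exact (Finset.measurable_fun_sum _ fun i _ => (measurable_const.indicator hA).comp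
        ((measurable_pi_apply i).comp measurable_snd)).div_const _
    filter_upwards [hreal] with p hp
    simpa using ENNReal.tendsto_ofReal hp

/-- Convergence of the means of products of indicators is convergence in distribution of the
shifted sequences, to a mixture of i.i.d. sequences. -/
theorem asymptoticallyExchangeable_of_tendsto [TopologicalSpace E] [SecondCountableTopology E]
    [BorelSpace E] {Y : ℕ → Ω → E} (hY : ∀ n, Measurable (Y n)) (hG : Measurable G)
    (hlim : ∀ (k : ℕ) (A : ℕ → Set E), (∀ i, MeasurableSet (A i)) →
      Tendsto (fun n => ∫ ω, ∏ i ∈ Finset.range k,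
          (A i).indicator (fun _ => (1 : ℝ)) (Y (n + i) ω) ∂P) atTop
        (𝓝 (∫ ω, ∏ i ∈ Finset.range k, (G ω : Measure E).real (A i) ∂P))) :
    AsymptoticallyExchangeable P Y G := by
  refine ⟨P ⊗ₘ iidKernel G hG, inferInstance, ?_, isDirectingMeasure_iidKernel, ?_⟩
  · exact Measure.fst_compProd P _
  have hYm : ∀ n, Measurable fun ω (i : ℕ) => Y (n + i) ω := fun n =>
    measurable_pi_lambda _ fun i => hY _
  refine ⟨fun n => (hYm n).aemeasurable, measurable_snd.aemeasurable, ?_⟩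
  -- Boxes form a π-system containing arbitrarily small neighbourhoods of each point, so convergence
  -- of their masses gives convergence in distribution.
  refine isPiSystem_boxes.tendsto_probabilityMeasure_of_tendsto_of_mem
    (fun s hs => measurableSet_of_mem_boxes hs) (fun u hu z hz => exists_mem_boxes_nhds hu hz) ?_
  rintro _ ⟨k, A, hA, rfl⟩
  refine tendsto_probabilityMeasure_apply ?_
  have hs : MeasurableSet (Set.pi (Finset.range k : Set ℕ) A) :=
    measurableSet_of_mem_boxes ⟨k, A, hA, rfl⟩
  have hreal := ENNReal.tendsto_ofReal (hlim k A hA)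
  simp only [ProbabilityMeasure.coe_mk]
  rw [Measure.map_apply measurable_snd hs, Measure.compProd_apply (measurable_snd hs)]
  simp_rw [Measure.map_apply (hYm _) hs]
  refine Tendsto.congr (fun n => ?_) (hreal.trans (le_of_eq (congrArg 𝓝 ?_)))
  · rw [← ofReal_measureReal (μ := P), ← integral_indicator_one (hYm n hs)]
    congr 1
    exact integral_congr_ae (Eventually.of_forall fun ω =>
      prod_indicator_eq_indicator_pi k A fun i => Y (n + i) ω)
  · rw [ofReal_integral_eq_lintegral_ofReal]
    · refine lintegral_congr fun ω => ?_
      rw [ENNReal.ofReal_prod_of_nonneg fun i _ => measureReal_nonneg]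
      exact (Finset.prod_congr rfl fun i _ => ofReal_measureReal).trans
        (Measure.infinitePi_pi _ fun i _ => hA i).symm
    · exact Integrable.of_bound (Finset.measurable_fun_prod _ fun i _ =>
        (measurable_coe_apply hG (hA i)).ennreal_toReal).aestronglyMeasurable 1
        (Eventually.of_forall fun ω => abs_prod_le_one _ fun i => abs_measureReal_le_one _ _)
    · exact Eventually.of_forall fun ω => Finset.prod_nonneg fun i _ => measureReal_nonneg

end Extension

end NewtonRule

theorem mainTheorem4
    {Ω Θ 𝕏 : Type*} [MeasurableSpace Ω]
    [TopologicalSpace Θ] [TopologicalSpace.MetrizableSpace Θ] [SecondCountableTopology Θ]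
    [MeasurableSpace Θ] [BorelSpace Θ] [StandardBorelSpace Θ]
    [MeasurableSpace 𝕏] [StandardBorelSpace 𝕏]
    (P : Measure Ω) [IsProbabilityMeasure P]
    (X : ℕ → Ω → 𝕏) (θ : ℕ → Ω → Θ)
    (μ : Measure 𝕏) [SigmaFinite μ]
    (f : Θ → 𝕏 → ℝ≥0∞) (hf : NewtonRule.IsDensityFamily μ f)
    (α : ℕ → ℝ) (hα : ∀ n, α n ∈ Set.Ioo (0 : ℝ) 1)
    (G₀ : ProbabilityMeasure Θ)
    (hident : NewtonRule.Identifiable μ f)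
    (hmodel : NewtonRule.IsNewtonModel P X θ μ f α hα G₀ ∨
      NewtonRule.IsSequentialNewtonModel P X θ μ f α hα G₀) :
    ∃ G : Ω → ProbabilityMeasure Θ,
      Measurable G ∧
      (∀ᵐ ω ∂P, Tendsto (fun n => NewtonRule.newtonRule α hα f G₀ n (fun i => X i ω))
        atTop (𝓝 (G ω))) ∧
      NewtonRule.AsymptoticallyExchangeable P θ G := by
  have hconv : NewtonRule.ConvergesSetwise P
      (fun n ω => NewtonRule.newtonRule α hα f G₀ n fun i => X i ω) G₀ :=
    hmodel.elim (fun h => (h.isMixturePredictive hf).convergesSetwise hf)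
      fun h => (h.isMixturePredictive hf).convergesSetwise hf
  obtain ⟨G, hGm, hG⟩ := hconv.exists_limit
  refine ⟨G, hGm, NewtonRule.ae_tendsto_of_forall_measurableSet hG,
    NewtonRule.asymptoticallyExchangeable_of_tendsto
      (hmodel.elim (fun h => h.measurable_latent) fun h => h.measurable_latent) hGm
      fun k A hA => ?_⟩
  -- Only here do the two schemes part; the original one also needs the mean of `G` to be `G₀`, for
  -- the replacement argument.
  rcases hmodel with h | h
  · exact h.tendsto_integral_prod hf hident hGm (hconv.lintegral_limit hG) hG k hA
  · refine h.tendsto_integral_prod hf (fun A hA => ?_) k hA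
    filter_upwards [hG A hA] with ω hω
    exact (ENNReal.tendsto_toReal (measure_ne_top _ _)).comp hω
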